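/- Let $V$ be a vertex operator algebra over $\mathbb C$ and $z$ a nonzero complex number. For a linear map $Y$ from $V$ to $(\mathrm{End}\,M)[[x,x^{-1}]]$ put $Y^{o}(v,x)=Y(e^{xL(1)}(-x^{-2})^{L(0)}v,x^{-1})$. A $V$-module means an ordinary module: a space with a vertex operator map satisfying the truncation condition, $Y(\mathbf 1,x)=1$, the Jacobi identity, the Virasoro relations and the $L(-1)$-derivative property, which is the direct sum of its $L(0)$-eigenspaces $W_{(h)}$ ($h\in\mathbb C$), with $\dim W_{(h)}<\infty$ and, for each $h$, $W_{(h-n)}=0$ for all large $n\in\mathbb N$. $V\otimes V$-modules are defined in the same way. Let $W$ be a $V$-module. Write $W'=\coprod_h W_{(h)}^{*}$ for the contragredient module, with $\langle Y(v,x)w',w\rangle=\langle w',Y^{o}(v,x)w\rangle$, and $\overline W=\prod_h W_{(h)}=(W')^{*}$, to which the action of $Y^{o}(v,x)$ on $W$ extends. Let $A$ be a $V\otimes V$-module, with $Y_1(v,x)=Y(v\otimes\mathbf 1,x)$ and $Y_2(v,x)=Y(\mathbf 1\otimes v,x)$. In delta-function expressions, powers of a binomial are expanded in nonnegative powers of its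 second term. A $Q(z)$-intertwining map from $A$ to $\overline W$ is a linear map $F:A\to\overline W$ such that, for all $v\in V$, $a\in A$, $$z^{-1}\delta\Big(\frac{x_1-x_0}{z}\Big)Y^{o}(v,x_0)F(a)=x_0^{-1}\delta\Big(\frac{x_1-z}{x_0}\Big)F(Y_1^{o}(v,x_1)a)-x_0^{-1}\delta\Big(\frac{z-x_1}{-x_0}\Big)F(Y_2(v,x_1)a);$$ these maps form a vector space $\mathcal M_{Q(z)}(A,W)$. For $\lambda\in A^{*}$ define $Y'_{Q(z)}(v,x_0)\lambda\in A^{*}[[x_0,x_0^{-1}]]$ by $$\langle Y'_{Q(z)}(v,x_0)\lambda,a\rangle=\mathrm{Res}_{x_1}\Big(x_0^{-1}\delta\Big(\frac{x_1-z}{x_0}\Big)\langle\lambda,Y_1^{o}(v,x_1)a\rangle-x_0^{-1}\delta\Big(\frac{z-x_1}{-x_0}\Big)\langle\lambda,Y_2(v,x_1)a\rangle\Big).$$ Let $\tilde T'_{Q(z)}(A)\subset A^{*}$ be the subspace of all $\lambda$ such that $Y'_{Q(z)}(v,x)\lambda\in A^{*}((x))$ for all $v\in V$ and $$z^{-1}\delta\Big(\frac{x_1-x_0}{z}\Big)\langle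 Y'_{Q(z)}(v,x_0)\lambda,a\rangle=x_0^{-1}\delta\Big(\frac{x_1-z}{x_0}\Big)\langle\lambda,Y_1^{o}(v,x_1)a\rangle-x_0^{-1}\delta\Big(\frac{z-x_1}{-x_0}\Big)\langle\lambda,Y_2(v,x_1)a\rangle$$ for all $v\in V$, $a\in A$. Let $T'_{Q(z)}(A)$ be the sum of all subspaces of $\tilde T'_{Q(z)}(A)$ that are stable under all components of $Y'_{Q(z)}(v,x)$, $v\in V$, and are (ordinary) $V$-modules under this action. For spaces $M_1,M_2$ on which $V$ acts by vertex operator maps, $\mathrm{Hom}_V(M_1,M_2)$ is the space of linear maps that commute with all these operators. **Theorem.** For $f\in\mathcal M_{Q(z)}(A,W)$, the restriction of $f^{*}:(\overline W)^{*}\to A^{*}$ to $W'\subset(\overline W)^{*}$ is a $V$-homomorphism from $W'$ to $T'_{Q(z)}(A)$ $(\subset A^{*})$. Moreover, the map $f\mapsto f^{*}|_{W'}$ is a linear isomorphism from $\mathcal M_{Q(z)}(A,W)$ onto $\mathrm{Hom}_V(W',T'_{Q(z)}(A))$. -/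

import Mathlib

open scoped TensorProduct

noncomputable section

universe uV uW uA

/-!
Throughout, a series `Y(v,x) = ∑ v_n x^{-n-1}` with coefficients in `End M` is given by its modes:
a linear map `Y : V →ₗ[ℂ] ℤ → Module.End ℂ M`, with `Y v n = v_n` the coefficient of `x^{-n-1}`.
Identities of formal series are identities of coefficients. Locally finite sums are written with
`∑ᶠ`; wherever they occur below the supports are finite.
-/

/-- The binomial coefficient `(s choose i)`, for an integer `s`, as a complex number. -/
def binom (s : ℤ) (i : ℕ) : ℂ := ((Ring.choose s i : ℤ) : ℂ)

/-- The data underlying a vertex operator algebra (the axioms are in `VOA` below): products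
`u_n v` with `u_n v = 0` for `n` large, the vacuum, the Virasoro element, the rank. -/
structure VertexData (V : Type uV) [AddCommGroup V] [Module ℂ V] where
  Y : V →ₗ[ℂ] ℤ → Module.End ℂ V
  truncation : ∀ u v : V, ∃ N : ℤ, ∀ n, N ≤ n → Y u n v = 0
  vac : V
  omega : V
  rank : ℂ

section Modules

variable {V : Type uV} [AddCommGroup V] [Module ℂ V]
variable {M : Type uW} [AddCommGroup M] [Module ℂ M]

/-- `L(n) = ω_{n+1}` acting on `M` through `Y`. -/
def VertexData.L (D : VertexData V) (Y : V →ₗ[ℂ] ℤ → Module.End ℂ M) (n : ℤ) :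
    Module.End ℂ M := Y D.omega (n + 1)

/-- The homogeneous subspace `M_(h)`: the eigenspace of `L(0)` with eigenvalue `h`. -/
def VertexData.wt (D : VertexData V) (Y : V →ₗ[ℂ] ℤ → Module.End ℂ M) (h : ℂ) :
    Submodule ℂ M := Module.End.eigenspace (D.L Y 0) h

/-- Weak modules. The field `jacobi` is the Jacobi identity
`x₀⁻¹δ((x₁-x₂)/x₀) Y(u,x₁)Y(v,x₂) - x₀⁻¹δ((x₂-x₁)/(-x₀)) Y(v,x₂)Y(u,x₁)
  = x₂⁻¹δ((x₁-x₀)/x₂) Y(Y(u,x₀)v,x₂)`,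
coefficient of `x₀^{-l-1} x₁^{-m-1} x₂^{-n-1}`. -/
structure IsWeakModule (D : VertexData V) (Y : V →ₗ[ℂ] ℤ → Module.End ℂ M) : Prop where
  truncation : ∀ (v : V) (w : M), ∃ N : ℤ, ∀ n, N ≤ n → Y v n w = 0
  vacuum : ∀ (n : ℤ) (w : M), Y D.vac n w = if n = -1 then w else 0
  jacobi : ∀ (u v : V) (w : M) (l m n : ℤ),
    ∑ᶠ i : ℕ, binom m i • Y (D.Y u (l + i) v) (m + n - i) w =
      ∑ᶠ i : ℕ, ((-1) ^ i * binom l i) •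
        (Y u (m + l - i) (Y v (n + i) w) - ((-1 : ℂ) ^ l) • Y v (n + l - i) (Y u (m + i) w))
  virasoro : ∀ (m n : ℤ) (w : M),
    D.L Y m (D.L Y n w) - D.L Y n (D.L Y m w) =
      ((m : ℂ) - n) • D.L Y (m + n) w +
        (if m + n = 0 then (((m : ℂ) ^ 3 - m) / 12 * D.rank) • w else 0)
  derivative : ∀ (v : V) (n : ℤ) (w : M),
    Y (D.L D.Y (-1) v) n w = (-(n : ℂ)) • Y v (n - 1) w

/-- (Ordinary) modules: weak modules that are the direct sum of the eigenspaces `M_(h)` of `L(0)`,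
`h ∈ ℂ`, with `dim M_(h) < ∞` and, for each `h`, `M_(h-n) = 0` for `n ∈ ℕ` large. -/
structure IsModule (D : VertexData V) (Y : V →ₗ[ℂ] ℤ → Module.End ℂ M) : Prop
    extends IsWeakModule D Y where
  semisimple : ⨆ h : ℂ, D.wt Y h = ⊤
  finite_dim : ∀ h : ℂ, FiniteDimensional ℂ (D.wt Y h)
  lower : ∀ h : ℂ, ∃ N : ℕ, ∀ n : ℕ, N ≤ n → D.wt Y (h - n) = ⊥

end Modules

/-- Vertex operator algebras. The `ℤ`-grading is the one by eigenvalues of `L(0)`. -/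
structure VOA (V : Type uV) [AddCommGroup V] [Module ℂ V] extends VertexData V where
  adjoint : IsWeakModule toVertexData toVertexData.Y
  creation : ∀ (v : V) (n : ℤ), 0 ≤ n → Y v n vac = 0
  creation' : ∀ v : V, Y v (-1) vac = v
  graded : ⨆ n : ℤ, toVertexData.wt toVertexData.Y (n : ℂ) = ⊤
  finite_dim : ∀ n : ℤ, FiniteDimensional ℂ (toVertexData.wt toVertexData.Y (n : ℂ))
  lower : ∃ N : ℤ, ∀ n : ℤ, n < N → toVertexData.wt toVertexData.Y (n : ℂ) = ⊥

/-- A module for a vertex operator algebra with underlying data `D`. -/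
structure VOAModule {V : Type uV} [AddCommGroup V] [Module ℂ V] (D : VertexData V)
    (W : Type uW) [AddCommGroup W] [Module ℂ W] where
  Y : V →ₗ[ℂ] ℤ → Module.End ℂ W
  isModule : IsModule D Y

/-! ### The tensor product algebra -/

section Tensor

variable {V : Type uV} [AddCommGroup V] [Module ℂ V]

/-- `u₁ ⊗ u₂ ↦ (u₁)_i ⊗ (u₂)_j`. -/
def VertexData.tensorTerm (D : VertexData V) (i j : ℤ) :
    V ⊗[ℂ] V →ₗ[ℂ] Module.End ℂ (V ⊗[ℂ] V) :=
  TensorProduct.lift ((TensorProduct.mapBilinear (RingHom.id ℂ) V V V V).compl₁₂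
    ((LinearMap.proj i).comp D.Y) ((LinearMap.proj j).comp D.Y))

theorem VertexData.tensorTerm_tmul (D : VertexData V) (i j : ℤ) (u₁ u₂ v₁ v₂ : V) :
    D.tensorTerm i j (u₁ ⊗ₜ u₂) (v₁ ⊗ₜ v₂) = D.Y u₁ i v₁ ⊗ₜ D.Y u₂ j v₂ := by
  simp [tensorTerm]

theorem VertexData.tensorTerm_bound (D : VertexData V) (x y : V ⊗[ℂ] V) :
    ∃ N : ℤ, ∀ i j : ℤ, N ≤ i ∨ N ≤ j → D.tensorTerm i j x y = 0 := by
  induction x with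
  | zero => exact ⟨0, by simp⟩
  | add x₁ x₂ h₁ h₂ =>
    obtain ⟨N₁, h₁⟩ := h₁
    obtain ⟨N₂, h₂⟩ := h₂
    refine ⟨max N₁ N₂, fun i j h => ?_⟩
    rw [map_add, LinearMap.add_apply, h₁ i j (by omega), h₂ i j (by omega), add_zero]
  | tmul u₁ u₂ =>
    induction y with
    | zero => exact ⟨0, by simp⟩
    | add y₁ y₂ h₁ h₂ =>
      obtain ⟨N₁, h₁⟩ := h₁
      obtain ⟨N₂, h₂⟩ := h₂
      refine ⟨max N₁ N₂, fun i j h => ?_⟩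
      rw [map_add, h₁ i j (by omega), h₂ i j (by omega), add_zero]
    | tmul v₁ v₂ =>
      obtain ⟨N₁, h₁⟩ := D.truncation u₁ v₁
      obtain ⟨N₂, h₂⟩ := D.truncation u₂ v₂
      refine ⟨max N₁ N₂, fun i j h => ?_⟩
      rw [D.tensorTerm_tmul]
      rcases h with h | h
      · rw [h₁ i (by omega), TensorProduct.zero_tmul]
      · rw [h₂ j (by omega), TensorProduct.tmul_zero]

theorem VertexData.tensorTerm_finite (D : VertexData V) (n : ℤ) (x y : V ⊗[ℂ] V) :
    (Function.support fun i : ℤ => D.tensorTerm i (n - 1 - i) x y).Finite := by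
  obtain ⟨N, hN⟩ := D.tensorTerm_bound x y
  refine (Set.finite_Icc (n - N) N).subset fun i hi => ?_
  by_contra hc
  refine hi (hN _ _ ?_)
  simp only [Set.mem_Icc, not_and_or, not_le] at hc
  omega

/-- The data of `V ⊗ V`: `Y(u₁ ⊗ u₂, x) = Y(u₁,x) ⊗ Y(u₂,x)`, that is
`(u₁ ⊗ u₂)_n (v₁ ⊗ v₂) = ∑_{i+j=n-1} (u₁)_i v₁ ⊗ (u₂)_j v₂`, with vacuum `𝟏 ⊗ 𝟏` and
Virasoro element `ω ⊗ 𝟏 + 𝟏 ⊗ ω`. -/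
def VertexData.tensorSquare (D : VertexData V) : VertexData (V ⊗[ℂ] V) where
  Y :=
    { toFun := fun x n =>
        { toFun := fun y => ∑ᶠ i : ℤ, D.tensorTerm i (n - 1 - i) x y
          map_add' := fun y₁ y₂ => by
            simp only [map_add]
            exact finsum_add_distrib (D.tensorTerm_finite n x y₁) (D.tensorTerm_finite n x y₂)
          map_smul' := fun c y => by
            simp only [map_smul, RingHom.id_apply]
            exact (smul_finsum' c (D.tensorTerm_finite n x y)).symm }
      map_add' := fun x₁ x₂ => by
        ext1 n
        refine LinearMap.ext fun y => ?_
        simp only [map_add, LinearMap.add_apply, LinearMap.coe_mk, AddHom.coe_mk, Pi.add_apply]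
        exact finsum_add_distrib (D.tensorTerm_finite n x₁ y) (D.tensorTerm_finite n x₂ y)
      map_smul' := fun c x => by
        ext1 n
        refine LinearMap.ext fun y => ?_
        simp only [map_smul, LinearMap.smul_apply, LinearMap.coe_mk, AddHom.coe_mk, Pi.smul_apply,
          RingHom.id_apply]
        exact (smul_finsum' c (D.tensorTerm_finite n x y)).symm }
  truncation := fun x y => by
    obtain ⟨N, hN⟩ := D.tensorTerm_bound x y
    refine ⟨2 * N + 1, fun n hn => ?_⟩
    simp only [LinearMap.coe_mk, AddHom.coe_mk]
    rw [← finsum_zero (α := ℤ)]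
    refine finsum_congr fun i => hN _ _ ?_
    omega
  vac := D.vac ⊗ₜ D.vac
  omega := D.omega ⊗ₜ D.vac + D.vac ⊗ₜ D.omega
  rank := D.rank + D.rank

end Tensor

/-! ### Homogeneous components and the opposite vertex operators -/

/-- The projection of `M` onto the eigenspace of `T` with eigenvalue `h`, when `M` is the direct
sum of the eigenspaces of `T` (and `0` otherwise). -/
def eigenProj {M : Type uW} [AddCommGroup M] [Module ℂ M] (T : Module.End ℂ M) (h : ℂ) :
    M →ₗ[ℂ] Module.End.eigenspace T h :=
  open Classical in
  if H : DirectSum.IsInternal (fun k : ℂ => Module.End.eigenspace T k) then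
    (DirectSum.component ℂ ℂ (fun k : ℂ => Module.End.eigenspace T k) h).comp
      (LinearEquiv.ofBijective
        (DirectSum.coeLinearMap fun k : ℂ => Module.End.eigenspace T k) H).symm.toLinearMap
  else 0

section EigenProj

variable {M : Type uW} [AddCommGroup M] [Module ℂ M]

theorem isInternal_eigenspace {T : Module.End ℂ M}
    (hT : ⨆ h : ℂ, Module.End.eigenspace T h = ⊤) :
    DirectSum.IsInternal (fun k : ℂ => Module.End.eigenspace T k) := by
  classical
  exact DirectSum.isInternal_submodule_of_iSupIndep_of_iSup_eq_top
    (Module.End.eigenspaces_iSupIndep T) hT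

theorem eigenProj_apply {T : Module.End ℂ M}
    (H : DirectSum.IsInternal (fun k : ℂ => Module.End.eigenspace T k)) (h : ℂ) (w : M) :
    eigenProj T h w = (LinearEquiv.ofBijective
      (DirectSum.coeLinearMap fun k : ℂ => Module.End.eigenspace T k) H).symm w h := by
  unfold eigenProj
  rw [dif_pos H]
  rfl

theorem eigenProj_finite (T : Module.End ℂ M) (w : M) :
    (Function.support fun h : ℂ => (eigenProj T h w : M)).Finite := by
  by_cases H : DirectSum.IsInternal (fun k : ℂ => Module.End.eigenspace T k)
  · refine (DFinsupp.finite_support ((LinearEquiv.ofBijective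
      (DirectSum.coeLinearMap fun k : ℂ => Module.End.eigenspace T k) H).symm w)).subset ?_
    intro h hh h0
    refine hh ?_
    have := eigenProj_apply H h w
    simp only
    rw [this]
    exact congrArg Subtype.val h0
  · have : ∀ h, eigenProj T h w = 0 := fun h => by
      unfold eigenProj
      rw [dif_neg H]
      rfl
    simp [this]

theorem eigenProj_of_mem {T : Module.End ℂ M} (hT : ⨆ h : ℂ, Module.End.eigenspace T h = ⊤)
    {k : ℂ} {w : M} (hw : w ∈ Module.End.eigenspace T k) {h : ℂ} (hk : h ≠ k) :
    eigenProj T h w = 0 := by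
  have H := isInternal_eigenspace hT
  have e : (LinearEquiv.ofBijective
      (DirectSum.coeLinearMap fun k : ℂ => Module.End.eigenspace T k) H).symm w
      = DirectSum.lof ℂ ℂ (fun k : ℂ => Module.End.eigenspace T k) k ⟨w, hw⟩ := by
    rw [LinearEquiv.symm_apply_eq]
    exact (DirectSum.coeLinearMap_lof (fun k : ℂ => Module.End.eigenspace T k) k
      (⟨w, hw⟩ : Module.End.eigenspace T k)).symm
  rw [eigenProj_apply H, e]
  exact DFinsupp.single_eq_of_ne hk

end EigenProj

section Opposite

variable {V : Type uV} [AddCommGroup V] [Module ℂ V]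
variable {M : Type uW} [AddCommGroup M] [Module ℂ M]

/-- `L(1)^j v_(m)`, where `v_(m)` is the component of `v` of weight `m`. -/
def VOA.oppTerm (𝒱 : VOA V) (p : ℤ × ℕ) : V →ₗ[ℂ] V :=
  ((𝒱.L 𝒱.Y 1) ^ p.2).comp
    ((Submodule.subtype _).comp (eigenProj (𝒱.L 𝒱.Y 0) (p.1 : ℂ)))

theorem VOA.L_one_pow_mem (𝒱 : VOA V) {m : ℂ} {v : V} (hv : v ∈ 𝒱.wt 𝒱.Y m) (j : ℕ) :
    ((𝒱.L 𝒱.Y 1) ^ j) v ∈ 𝒱.wt 𝒱.Y (m - j) := by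
  induction j with
  | zero => simpa using hv
  | succ j ih =>
    rw [pow_succ', Module.End.mul_apply]
    generalize ((𝒱.L 𝒱.Y 1) ^ j) v = y at ih
    unfold VertexData.wt at ih ⊢
    rw [Module.End.mem_eigenspace_iff] at ih ⊢
    have h := 𝒱.adjoint.virasoro 0 1 y
    rw [ih] at h
    simp only [map_smul, Int.cast_zero, Int.cast_one, zero_add, one_ne_zero, if_false,
      add_zero, zero_sub, neg_smul, one_smul] at h
    rw [sub_eq_iff_eq_add] at h
    rw [h]
    push_cast
    module

theorem VOA.oppTerm_mem (𝒱 : VOA V) (p : ℤ × ℕ) (v : V) :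
    𝒱.oppTerm p v ∈ 𝒱.wt 𝒱.Y ((p.1 : ℂ) - p.2) :=
  𝒱.L_one_pow_mem (eigenProj (𝒱.L 𝒱.Y 0) (p.1 : ℂ) v).2 p.2

theorem VOA.oppTerm_finite (𝒱 : VOA V) (v : V) :
    (Function.support fun p : ℤ × ℕ => 𝒱.oppTerm p v).Finite := by
  obtain ⟨N, hN⟩ := 𝒱.lower
  have h1 : {m : ℤ | (eigenProj (𝒱.L 𝒱.Y 0) (m : ℂ) v : V) ≠ 0}.Finite :=
    Set.Finite.preimage (Int.cast_injective.injOn) (eigenProj_finite (𝒱.L 𝒱.Y 0) v)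
  refine (h1.biUnion (t := fun m => (fun j : ℕ => ((m, j) : ℤ × ℕ)) '' Set.Iic (m - N).toNat)
    fun m _ => (Set.finite_Iic _).image _).subset ?_
  rintro ⟨m, j⟩ hp
  simp only [Set.mem_iUnion]
  refine ⟨m, ?_, j, ?_, rfl⟩
  · intro h0
    refine hp ?_
    simp [VOA.oppTerm, h0]
  · by_contra hj
    refine hp ?_
    have hmem := 𝒱.oppTerm_mem (m, j) v
    have hlt : m - (j : ℤ) < N := by
      simp only [Set.mem_Iic] at hj
      omega
    have h2 := hN _ hlt
    push_cast at h2
    rw [h2] at hmem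
    exact (Submodule.mem_bot ℂ).1 hmem

theorem VOA.opp_finite (𝒱 : VOA V) (Y : V →ₗ[ℂ] ℤ → Module.End ℂ M) (v : V) (n : ℤ) :
    (Function.support fun p : ℤ × ℕ => ((-1 : ℂ) ^ p.1 / (p.2.factorial : ℂ)) •
      Y (𝒱.oppTerm p v) (2 * p.1 - n - 2 - p.2)).Finite := by
  refine (𝒱.oppTerm_finite v).subset fun p hp h0 => hp ?_
  have h0' : 𝒱.oppTerm p v = 0 := h0
  simp [h0']

/-- The opposite vertex operator `Y^o(v,x) = Y(e^{xL(1)}(-x^{-2})^{L(0)} v, x^{-1})`.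
For `v` of weight `m` its coefficient of `x^{-n-1}` is
`∑_{j ≥ 0} ((-1)^m / j!) (L(1)^j v)_{2m-n-2-j}`. -/
def VOA.opp (𝒱 : VOA V) (Y : V →ₗ[ℂ] ℤ → Module.End ℂ M) : V →ₗ[ℂ] ℤ → Module.End ℂ M where
  toFun v n := ∑ᶠ p : ℤ × ℕ, ((-1 : ℂ) ^ p.1 / (p.2.factorial : ℂ)) •
    Y (𝒱.oppTerm p v) (2 * p.1 - n - 2 - p.2)
  map_add' u v := by
    ext1 n
    simp only [map_add, Pi.add_apply, smul_add]
    exact finsum_add_distrib (𝒱.opp_finite Y u n) (𝒱.opp_finite Y v n)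
  map_smul' c v := by
    ext1 n
    simp only [map_smul, Pi.smul_apply, RingHom.id_apply]
    rw [smul_finsum' c (𝒱.opp_finite Y v n)]
    exact finsum_congr fun p => smul_comm _ _ _

theorem VOA.opp_apply (𝒱 : VOA V) (Y : V →ₗ[ℂ] ℤ → Module.End ℂ M) (v : V) (n : ℤ) (w : M) :
    𝒱.opp Y v n w = ∑ p ∈ (𝒱.oppTerm_finite v).toFinset,
      ((-1 : ℂ) ^ p.1 / (p.2.factorial : ℂ)) •
        Y (𝒱.oppTerm p v) (2 * p.1 - n - 2 - p.2) w := by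
  have : 𝒱.opp Y v n = ∑ p ∈ (𝒱.oppTerm_finite v).toFinset,
      ((-1 : ℂ) ^ p.1 / (p.2.factorial : ℂ)) •
        Y (𝒱.oppTerm p v) (2 * p.1 - n - 2 - p.2) := by
    refine finsum_eq_sum_of_support_subset _ fun p hp => ?_
    simp only [Set.Finite.coe_toFinset]
    intro h0
    refine hp ?_
    have h0' : 𝒱.oppTerm p v = 0 := h0
    simp [h0']
  rw [this, LinearMap.sum_apply]
  rfl

/-- `Y^o(v,x)w ∈ M((x⁻¹))`. -/
theorem VOA.opp_truncation (𝒱 : VOA V) (Y : V →ₗ[ℂ] ℤ → Module.End ℂ M)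
    (hY : ∀ (v : V) (w : M), ∃ N : ℤ, ∀ n, N ≤ n → Y v n w = 0) (v : V) (w : M) :
    ∃ N : ℤ, ∀ n, n ≤ N → 𝒱.opp Y v n w = 0 := by
  choose N hN using fun p : ℤ × ℕ => hY (𝒱.oppTerm p v) w
  obtain ⟨B, hB⟩ := ((𝒱.oppTerm_finite v).toFinset.image
    fun p => 2 * p.1 - 2 - p.2 - N p).bddBelow
  refine ⟨B, fun n hn => ?_⟩
  rw [𝒱.opp_apply]
  refine Finset.sum_eq_zero fun p hp => ?_
  have := hB (Finset.mem_coe.2 (Finset.mem_image_of_mem _ hp))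
  rw [hN p _ (by linarith), smul_zero]

/-- `v_n M_(h) ⊆ M_(h+m-n-1)` for `v` of weight `m`. -/
theorem IsWeakModule.mode_mem {D : VertexData V} {Y : V →ₗ[ℂ] ℤ → Module.End ℂ M}
    (hY : IsWeakModule D Y) {m h : ℂ} {v : V} {w : M} (hv : v ∈ D.wt D.Y m)
    (hw : w ∈ D.wt Y h) (n : ℤ) : Y v n w ∈ D.wt Y (h + m - n - 1) := by
  have hv' : D.Y D.omega 1 v = m • v := by
    simpa [VertexData.wt, VertexData.L, Module.End.mem_eigenspace_iff] using hv
  have hw' : Y D.omega 1 w = h • w := by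
    simpa [VertexData.wt, VertexData.L, Module.End.mem_eigenspace_iff] using hw
  have hd : Y (D.Y D.omega 0 v) (n + 1) w = (-((n : ℂ) + 1)) • Y v n w := by
    simpa [VertexData.L] using hY.derivative v (n + 1) w
  have hj := hY.jacobi D.omega v w 0 1 n
  have e1 : ∑ᶠ i : ℕ, binom 1 i • Y (D.Y D.omega (0 + i) v) (1 + n - i) w =
      ∑ i ∈ Finset.range 2, binom 1 i • Y (D.Y D.omega (0 + i) v) (1 + n - i) w := by
    refine finsum_eq_sum_of_support_subset _ fun i hi => ?_
    simp only [Finset.coe_range, Set.mem_Iio]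
    by_contra hc
    refine hi ?_
    have : Ring.choose (1 : ℤ) i = 0 := by
      have h3 := Ring.choose_natCast (R := ℤ) 1 i
      rw [Nat.choose_eq_zero_of_lt (by omega)] at h3
      simpa using h3
    simp [binom, this]
  have e2 : ∑ᶠ i : ℕ, ((-1) ^ i * binom 0 i) •
        (Y D.omega (1 + 0 - i) (Y v (n + i) w) -
          ((-1 : ℂ) ^ (0 : ℤ)) • Y v (n + 0 - i) (Y D.omega (1 + i) w)) =
      ∑ i ∈ Finset.range 1, ((-1) ^ i * binom 0 i) •
        (Y D.omega (1 + 0 - i) (Y v (n + i) w) -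
          ((-1 : ℂ) ^ (0 : ℤ)) • Y v (n + 0 - i) (Y D.omega (1 + i) w)) := by
    refine finsum_eq_sum_of_support_subset _ fun i hi => ?_
    simp only [Finset.coe_range, Set.mem_Iio]
    by_contra hc
    refine hi ?_
    have : Ring.choose (0 : ℤ) i = 0 := by
      have h3 := Ring.choose_natCast (R := ℤ) 0 i
      rw [Nat.choose_eq_zero_of_lt (by omega)] at h3
      simpa using h3
    simp [binom, this]
  rw [e1, e2] at hj
  simp only [Finset.sum_range_succ, Finset.sum_range_zero, zero_add, binom, Ring.choose_zero_right,
    Ring.choose_one_right, Int.cast_one, one_smul, Nat.cast_zero, Nat.cast_one, sub_zero, add_zero,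
    pow_zero, mul_one, zpow_zero, hv', hw', map_smul, Pi.smul_apply, LinearMap.smul_apply] at hj
  rw [show (1 : ℤ) + n = n + 1 by ring, hd, show n + 1 - 1 = n by ring] at hj
  unfold VertexData.wt VertexData.L
  rw [Module.End.mem_eigenspace_iff]
  have hj' := eq_add_of_sub_eq hj.symm
  simp only [zero_add]
  rw [hj']
  module

theorem VOA.opp_term_mem (𝒱 : VOA V) {Y : V →ₗ[ℂ] ℤ → Module.End ℂ M}
    (hY : IsWeakModule 𝒱.toVertexData Y) (v : V) {h : ℂ} {w : M} (hw : w ∈ 𝒱.wt Y h)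
    (n : ℤ) (p : ℤ × ℕ) :
    Y (𝒱.oppTerm p v) (2 * p.1 - n - 2 - p.2) w ∈ 𝒱.wt Y (h + n + 1 - p.1) := by
  have := hY.mode_mem (𝒱.oppTerm_mem p v) hw (2 * p.1 - n - 2 - p.2)
  convert this using 2
  push_cast
  ring

end Opposite

/-! ### The restricted dual, the contragredient module and the completion -/

section Dual

variable {V : Type uV} [AddCommGroup V] [Module ℂ V]
variable {W : Type uW} [AddCommGroup W] [Module ℂ W]

/-- The restricted dual `W' = ∐ W_(h)^*`, as the space of those linear functionals on `W` that
vanish on `W_(h)` for all but finitely many `h`. -/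
def restrictedDual {D : VertexData V} (𝒲 : VOAModule D W) :
    Submodule ℂ (Module.Dual ℂ W) where
  carrier := {α | {h : ℂ | ∃ w ∈ D.wt 𝒲.Y h, α w ≠ 0}.Finite}
  zero_mem' := by simp
  add_mem' {α β} hα hβ := by
    refine (hα.union hβ).subset ?_
    rintro h ⟨w, hw, hne⟩
    by_cases h0 : α w = 0
    · exact Or.inr ⟨w, hw, by simpa [h0] using hne⟩
    · exact Or.inl ⟨w, hw, h0⟩
  smul_mem' c α hα := by
    refine hα.subset ?_
    rintro h ⟨w, hw, hne⟩
    exact ⟨w, hw, fun h0 => hne (by simp [h0])⟩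

/-- The formal completion `∏ W_(h)`. -/
abbrev completion {D : VertexData V} (𝒲 : VOAModule D W) : Type uW :=
  ∀ h : ℂ, D.wt 𝒲.Y h

theorem pairing_finite {D : VertexData V} (𝒲 : VOAModule D W) (α : restrictedDual 𝒲)
    (f : completion 𝒲) : (Function.support fun h : ℂ => (α : Module.Dual ℂ W) (f h)).Finite :=
  Set.Finite.subset α.2 fun h hh => ⟨f h, (f h).2, hh⟩

/-- The inclusion of `W'` in the dual of the completion:
`⟨α, (w_h)_h⟩ = ∑_h α(w_h)`. -/
def pairing {D : VertexData V} (𝒲 : VOAModule D W) :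
    restrictedDual 𝒲 →ₗ[ℂ] Module.Dual ℂ (completion 𝒲) where
  toFun α :=
    { toFun := fun f => ∑ᶠ h : ℂ, (α : Module.Dual ℂ W) (f h)
      map_add' := fun f g => by
        simp only [Pi.add_apply, Submodule.coe_add, map_add]
        exact finsum_add_distrib (pairing_finite 𝒲 α f) (pairing_finite 𝒲 α g)
      map_smul' := fun c f => by
        simp only [Pi.smul_apply, Submodule.coe_smul, map_smul, RingHom.id_apply]
        exact (smul_finsum' c (pairing_finite 𝒲 α f)).symm }
  map_add' α β := by
    refine LinearMap.ext fun f => ?_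
    simp only [Submodule.coe_add, LinearMap.add_apply, LinearMap.coe_mk, AddHom.coe_mk]
    exact finsum_add_distrib (pairing_finite 𝒲 α f) (pairing_finite 𝒲 β f)
  map_smul' c α := by
    refine LinearMap.ext fun f => ?_
    simp only [Submodule.coe_smul, LinearMap.smul_apply, LinearMap.coe_mk, AddHom.coe_mk,
      RingHom.id_apply]
    exact (smul_finsum' c (pairing_finite 𝒲 α f)).symm

/-- A subspace is stable under all the operators `v_n`. -/
def IsStable (Y : V →ₗ[ℂ] ℤ → Module.End ℂ W) (U : Submodule ℂ W) : Prop :=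
  ∀ (v : V) (n : ℤ), ∀ x ∈ U, Y v n x ∈ U

/-- The restriction of the operators `v_n` to a stable subspace. -/
def restrictY (Y : V →ₗ[ℂ] ℤ → Module.End ℂ W) (U : Submodule ℂ W) (hU : IsStable Y U) :
    V →ₗ[ℂ] ℤ → Module.End ℂ U where
  toFun v n := (Y v n).restrict (hU v n)
  map_add' u v := by
    ext
    simp [LinearMap.restrict_apply]
  map_smul' c v := by
    ext
    simp [LinearMap.restrict_apply]

/-- The transposes of the operators `v_n`. -/
def dualY (Y : V →ₗ[ℂ] ℤ → Module.End ℂ W) : V →ₗ[ℂ] ℤ → Module.End ℂ (Module.Dual ℂ W) where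
  toFun v n := (Y v n).dualMap
  map_add' u v := by
    ext
    simp
  map_smul' c v := by
    ext
    simp

theorem restrictedDual_stable (𝒱 : VOA V) (𝒲 : VOAModule 𝒱.toVertexData W) :
    IsStable (dualY (𝒱.opp 𝒲.Y)) (restrictedDual 𝒲) := by
  intro v n α hα
  refine ((𝒱.oppTerm_finite v).biUnion
    (t := fun p => (fun k : ℂ => k - n - 1 + p.1) ''
      {h : ℂ | ∃ w ∈ 𝒱.wt 𝒲.Y h, α w ≠ 0}) fun p _ => Set.Finite.image _ hα).subset ?_
  rintro h ⟨w, hw, hne⟩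
  have e : dualY (𝒱.opp 𝒲.Y) v n α w = α (𝒱.opp 𝒲.Y v n w) := rfl
  rw [e, 𝒱.opp_apply, map_sum] at hne
  obtain ⟨p, hp, hpne⟩ := Finset.exists_ne_zero_of_sum_ne_zero hne
  rw [map_smul] at hpne
  simp only [Set.mem_iUnion]
  refine ⟨p, by simpa using hp, h + n + 1 - p.1, ⟨_,
    𝒱.opp_term_mem 𝒲.isModule.toIsWeakModule v hw n p, fun h0 => hpne (by rw [h0, smul_zero])⟩, ?_⟩
  simp only
  ring

/-- The contragredient vertex operators on `W'`: `⟨Y(v,x)α, w⟩ = ⟨α, Y^o(v,x)w⟩`. -/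
def contragredientY (𝒱 : VOA V) (𝒲 : VOAModule 𝒱.toVertexData W) :
    V →ₗ[ℂ] ℤ → Module.End ℂ (restrictedDual 𝒲) :=
  restrictY (dualY (𝒱.opp 𝒲.Y)) (restrictedDual 𝒲) (restrictedDual_stable 𝒱 𝒲)

/-- The component of weight `k` of `v^o_n w`, for `w` of weight `h`. -/
theorem eigenProj_opp_support (𝒱 : VOA V) (𝒲 : VOAModule 𝒱.toVertexData W) (v : V) (n : ℤ)
    {h k : ℂ} {w : W} (hw : w ∈ 𝒱.wt 𝒲.Y h)
    (hne : eigenProj (𝒱.L 𝒲.Y 0) k (𝒱.opp 𝒲.Y v n w) ≠ 0) :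
    ∃ p ∈ (𝒱.oppTerm_finite v).toFinset, h = k - n - 1 + p.1 := by
  rw [𝒱.opp_apply, map_sum] at hne
  obtain ⟨p, hp, hpne⟩ := Finset.exists_ne_zero_of_sum_ne_zero hne
  refine ⟨p, hp, ?_⟩
  by_contra hc
  refine hpne ?_
  rw [map_smul, eigenProj_of_mem 𝒲.isModule.semisimple
    (𝒱.opp_term_mem 𝒲.isModule.toIsWeakModule v hw n p), smul_zero]
  intro h0
  refine hc ?_
  rw [h0]
  ring

theorem extend_finite (𝒱 : VOA V) (𝒲 : VOAModule 𝒱.toVertexData W) (v : V) (n : ℤ)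
    (f : completion 𝒲) (k : ℂ) : (Function.support fun h : ℂ =>
      eigenProj (𝒱.L 𝒲.Y 0) k (𝒱.opp 𝒲.Y v n (f h))).Finite := by
  refine (((𝒱.oppTerm_finite v).toFinset.image fun p => k - n - 1 + (p.1 : ℂ)).finite_toSet).subset
    fun h hh => ?_
  obtain ⟨p, hp, e⟩ := eigenProj_opp_support 𝒱 𝒲 v n (f h).2 hh
  exact Finset.mem_coe.2 (Finset.mem_image.2 ⟨p, hp, e.symm⟩)

/-- The extension of the operators of `Y^o(v,x)` from `W` to the completion: the component of
weight `k` of `v^o_n (w_h)_h` is the sum over `h` of the components of weight `k` of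
`v^o_n w_h`. -/
def extendOpp (𝒱 : VOA V) (𝒲 : VOAModule 𝒱.toVertexData W) (v : V) (n : ℤ) :
    completion 𝒲 →ₗ[ℂ] completion 𝒲 where
  toFun f k := ∑ᶠ h : ℂ, eigenProj (𝒱.L 𝒲.Y 0) k (𝒱.opp 𝒲.Y v n (f h))
  map_add' f g := by
    ext1 k
    simp only [Pi.add_apply, Submodule.coe_add, map_add]
    exact finsum_add_distrib (extend_finite 𝒱 𝒲 v n f k) (extend_finite 𝒱 𝒲 v n g k)
  map_smul' c f := by
    ext1 k
    simp only [Pi.smul_apply, Submodule.coe_smul, map_smul, RingHom.id_apply]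
    exact (smul_finsum' c (extend_finite 𝒱 𝒲 v n f k)).symm

/-- Each homogeneous component of `Y^o(v,x)f` is truncated from below. -/
theorem extendOpp_truncation (𝒱 : VOA V) (𝒲 : VOAModule 𝒱.toVertexData W) (v : V)
    (f : completion 𝒲) (k : ℂ) : ∃ N : ℤ, ∀ n, N ≤ n → extendOpp 𝒱 𝒲 v n f k = 0 := by
  choose N hN using fun p : ℤ × ℕ => 𝒲.isModule.lower (k - 1 + p.1)
  obtain ⟨B, hB⟩ := ((𝒱.oppTerm_finite v).toFinset.image fun p => (N p : ℤ)).bddAbove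
  refine ⟨max B 0, fun n hn => ?_⟩
  simp only [extendOpp, LinearMap.coe_mk, AddHom.coe_mk]
  refine finsum_eq_zero_of_forall_eq_zero fun h => ?_
  by_contra hne
  obtain ⟨p, hp, e⟩ := eigenProj_opp_support 𝒱 𝒲 v n (f h).2 hne
  have hB' := hB (Finset.mem_coe.2 (Finset.mem_image_of_mem _ hp))
  have hb := hN p n.toNat (by omega)
  have hcast : ((n.toNat : ℕ) : ℂ) = (n : ℂ) := by
    have : ((n.toNat : ℕ) : ℤ) = n := Int.toNat_of_nonneg (by omega)
    exact_mod_cast congrArg (Int.cast : ℤ → ℂ) this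
  have he : k - 1 + (p.1 : ℂ) - ((n.toNat : ℕ) : ℂ) = h := by
    rw [hcast, e]
    ring
  rw [he] at hb
  have hf : (f h : W) = 0 := by
    have hf' : (f h : W) ∈ (⊥ : Submodule ℂ W) := hb.le (f h).2
    exact (Submodule.mem_bot ℂ).1 hf'
  refine hne ?_
  rw [hf, map_zero, map_zero]
  rfl

end Dual

/-! ### Homomorphisms -/

/-- `Hom_V(M₁, M₂)`: the linear maps `g` with `g(Y(v,x)m) = Y(v,x)g(m)` for `v ∈ V`. -/
def homV {V : Type uV} [AddCommGroup V] [Module ℂ V]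
    {M₁ : Type uW} [AddCommGroup M₁] [Module ℂ M₁] {M₂ : Type uA} [AddCommGroup M₂] [Module ℂ M₂]
    (Y₁ : V →ₗ[ℂ] ℤ → Module.End ℂ M₁) (Y₂ : V →ₗ[ℂ] ℤ → Module.End ℂ M₂) :
    Submodule ℂ (M₁ →ₗ[ℂ] M₂) where
  carrier := {g | ∀ (v : V) (n : ℤ) (m : M₁), g (Y₁ v n m) = Y₂ v n (g m)}
  zero_mem' := by simp
  add_mem' {f g} hf hg := fun v n m => by simp [hf v n m, hg v n m]
  smul_mem' c f hf := fun v n m => by simp [hf v n m]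

/-! ### `Q(z)`-intertwining maps and the space `T'_{Q(z)}(A)` -/

section Qz

variable {V : Type uV} [AddCommGroup V] [Module ℂ V]
variable {W : Type uW} [AddCommGroup W] [Module ℂ W]
variable {A : Type uA} [AddCommGroup A] [Module ℂ A]

/-- `Y₁(v,x) = Y(v ⊗ 𝟏, x)`. -/
def leftY {D : VertexData V} (𝒜 : VOAModule D.tensorSquare A) : V →ₗ[ℂ] ℤ → Module.End ℂ A :=
  𝒜.Y.comp ((TensorProduct.mk ℂ V V).flip D.vac)

/-- `Y₂(v,x) = Y(𝟏 ⊗ v, x)`. -/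
def rightY {D : VertexData V} (𝒜 : VOAModule D.tensorSquare A) : V →ₗ[ℂ] ℤ → Module.End ℂ A :=
  𝒜.Y.comp (TensorProduct.mk ℂ V V D.vac)

variable (𝒱 : VOA V) (𝒜 : VOAModule 𝒱.tensorSquare A) (z : ℂ)

theorem qz_left_finite (v : V) (s t : ℤ) (a : A) : (Function.support fun i : ℕ =>
    (binom s i * (-z) ^ i) • 𝒱.opp (leftY 𝒜) v (s + t - i) a).Finite := by
  obtain ⟨N, hN⟩ := 𝒱.opp_truncation (leftY 𝒜)
    (fun v w => 𝒜.isModule.truncation (v ⊗ₜ 𝒱.vac) w) v a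
  refine (Set.finite_Iic (s + t - N).toNat).subset fun i hi => ?_
  by_contra hc
  refine hi ?_
  simp only [Set.mem_Iic] at hc
  simp only
  rw [hN _ (by omega), smul_zero]

theorem qz_right_finite (v : V) (s t : ℤ) (a : A) : (Function.support fun i : ℕ =>
    (binom s i * (-z) ^ (s - i)) • rightY 𝒜 v (t + i) a).Finite := by
  obtain ⟨N, hN⟩ := 𝒜.isModule.truncation (𝒱.vac ⊗ₜ v) a
  refine (Set.finite_Iic (N - t).toNat).subset fun i hi => ?_
  by_contra hc
  refine hi ?_
  simp only [Set.mem_Iic] at hc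
  have : rightY 𝒜 v (t + i) a = 0 := hN _ (by omega)
  simp only
  rw [this, smul_zero]

/-- The coefficient of `x₀^{-s-1} x₁^{-t-1}` in
`x₀⁻¹δ((x₁-z)/x₀) Y₁^o(v,x₁)a - x₀⁻¹δ((z-x₁)/(-x₀)) Y₂(v,x₁)a`,
that is, the residue in `x₁` of `x₁^t (x₁-z)^s Y₁^o(v,x₁)a - x₁^t (-z+x₁)^s Y₂(v,x₁)a`, where
`(x₁-z)^s` is expanded in nonnegative powers of `z` and `(-z+x₁)^s` in those of `x₁`. -/
def qzTerm (s t : ℤ) : V →ₗ[ℂ] Module.End ℂ A :=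
  LinearMap.mk₂ ℂ
    (fun v a =>
      (∑ᶠ i : ℕ, (binom s i * (-z) ^ i) • 𝒱.opp (leftY 𝒜) v (s + t - i) a) -
        ∑ᶠ i : ℕ, (binom s i * (-z) ^ (s - i)) • rightY 𝒜 v (t + i) a)
    (fun u v a => by
      simp only [map_add, Pi.add_apply, LinearMap.add_apply, smul_add]
      rw [finsum_add_distrib (qz_left_finite 𝒱 𝒜 z u s t a) (qz_left_finite 𝒱 𝒜 z v s t a),
        finsum_add_distrib (qz_right_finite 𝒱 𝒜 z u s t a) (qz_right_finite 𝒱 𝒜 z v s t a)]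
      abel)
    (fun c v a => by
      simp only [map_smul, Pi.smul_apply, LinearMap.smul_apply]
      rw [smul_sub, smul_finsum' c (qz_left_finite 𝒱 𝒜 z v s t a),
        smul_finsum' c (qz_right_finite 𝒱 𝒜 z v s t a)]
      simp only [smul_comm c])
    (fun v a b => by
      simp only [map_add, smul_add]
      rw [finsum_add_distrib (qz_left_finite 𝒱 𝒜 z v s t a) (qz_left_finite 𝒱 𝒜 z v s t b),
        finsum_add_distrib (qz_right_finite 𝒱 𝒜 z v s t a) (qz_right_finite 𝒱 𝒜 z v s t b)]
      abel)
    (fun c v a => by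
      simp only [map_smul]
      rw [smul_sub, smul_finsum' c (qz_left_finite 𝒱 𝒜 z v s t a),
        smul_finsum' c (qz_right_finite 𝒱 𝒜 z v s t a)]
      simp only [smul_comm c])

theorem qz_middle_finite (𝒲 : VOAModule 𝒱.toVertexData W) (v : V) (s t : ℤ) (f : completion 𝒲)
    (k : ℂ) : (Function.support fun i : ℕ =>
      (binom t i * z ^ (t - i)) • extendOpp 𝒱 𝒲 v (s + i) f k).Finite := by
  obtain ⟨N, hN⟩ := extendOpp_truncation 𝒱 𝒲 v f k
  refine (Set.finite_Iic (N - s).toNat).subset fun i hi => ?_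
  by_contra hc
  refine hi ?_
  simp only [Set.mem_Iic] at hc
  simp only
  rw [hN _ (by omega), smul_zero]

/-- The space `M_{Q(z)}(A,W)` of `Q(z)`-intertwining maps from `A` to the completion of `W`:
linear maps `F` with
`z⁻¹δ((x₁-x₀)/z) Y^o(v,x₀)F(a)
  = x₀⁻¹δ((x₁-z)/x₀) F(Y₁^o(v,x₁)a) - x₀⁻¹δ((z-x₁)/(-x₀)) F(Y₂(v,x₁)a)`.
The identity is that of the coefficients of `x₀^{-s-1} x₁^{-t-1}`; on the left this is the residue
in `x₀` of `x₀^s (z+x₀)^t Y^o(v,x₀)F(a)`, a sum that is finite in each homogeneous component. -/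
def intertwiningMaps (𝒲 : VOAModule 𝒱.toVertexData W) :
    Submodule ℂ (A →ₗ[ℂ] completion 𝒲) where
  carrier := {F | ∀ (v : V) (a : A) (s t : ℤ) (k : ℂ),
    ∑ᶠ i : ℕ, (binom t i * z ^ (t - i)) • extendOpp 𝒱 𝒲 v (s + i) (F a) k =
      F (qzTerm 𝒱 𝒜 z s t v a) k}
  zero_mem' := by simp
  add_mem' {F G} hF hG := fun v a s t k => by
    simp only [LinearMap.add_apply, map_add, Pi.add_apply, smul_add]
    rw [finsum_add_distrib (qz_middle_finite 𝒱 z 𝒲 v s t (F a) k)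
      (qz_middle_finite 𝒱 z 𝒲 v s t (G a) k), hF v a s t k, hG v a s t k]
  smul_mem' c F hF := fun v a s t k => by
    simp only [LinearMap.smul_apply, map_smul, Pi.smul_apply]
    rw [← hF v a s t k, smul_finsum' c (qz_middle_finite 𝒱 z 𝒲 v s t (F a) k)]
    simp only [smul_comm c]

/-- The action `Y'_{Q(z)}` of `V` on `A^*`:
`⟨Y'_{Q(z)}(v,x₀)λ, a⟩ = Res_{x₁} x₀⁻¹δ((x₁-z)/x₀)⟨λ, Y₁^o(v,x₁)a⟩
  - Res_{x₁} x₀⁻¹δ((z-x₁)/(-x₀))⟨λ, Y₂(v,x₁)a⟩`. -/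
def qzY : V →ₗ[ℂ] ℤ → Module.End ℂ (Module.Dual ℂ A) :=
  dualY (LinearMap.pi fun s : ℤ => qzTerm 𝒱 𝒜 z s 0)

theorem qzY_finite (v : V) (s t : ℤ) (lam : Module.Dual ℂ A)
    (h : ∃ N : ℤ, ∀ n, N ≤ n → qzY 𝒱 𝒜 z v n lam = 0) (a : A) :
    (Function.support fun i : ℕ =>
      (binom t i * z ^ (t - i)) • qzY 𝒱 𝒜 z v (s + i) lam a).Finite := by
  obtain ⟨N, hN⟩ := h
  refine (Set.finite_Iic (N - s).toNat).subset fun i hi => ?_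
  by_contra hc
  refine hi ?_
  simp only [Set.mem_Iic] at hc
  simp only
  rw [hN _ (by omega), LinearMap.zero_apply, smul_zero]

/-- The space of linear functionals on `A` that satisfy the `Q(z)`-compatibility condition:
lower truncation, `Y'_{Q(z)}(v,x)λ ∈ A^*((x))`, and
`z⁻¹δ((x₁-x₀)/z)⟨Y'_{Q(z)}(v,x₀)λ, a⟩
  = x₀⁻¹δ((x₁-z)/x₀)⟨λ, Y₁^o(v,x₁)a⟩ - x₀⁻¹δ((z-x₁)/(-x₀))⟨λ, Y₂(v,x₁)a⟩`. -/
def compatible : Submodule ℂ (Module.Dual ℂ A) where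
  carrier := {lam | (∀ v : V, ∃ N : ℤ, ∀ n, N ≤ n → qzY 𝒱 𝒜 z v n lam = 0) ∧
    ∀ (v : V) (a : A) (s t : ℤ),
      ∑ᶠ i : ℕ, (binom t i * z ^ (t - i)) • qzY 𝒱 𝒜 z v (s + i) lam a =
        lam (qzTerm 𝒱 𝒜 z s t v a)}
  zero_mem' := ⟨fun v => ⟨0, by simp⟩, by simp⟩
  add_mem' {f g} hf hg := by
    refine ⟨fun v => ?_, fun v a s t => ?_⟩
    · obtain ⟨N₁, h₁⟩ := hf.1 v
      obtain ⟨N₂, h₂⟩ := hg.1 v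
      refine ⟨max N₁ N₂, fun n hn => ?_⟩
      rw [map_add, h₁ n (by omega), h₂ n (by omega), add_zero]
    · simp only [LinearMap.add_apply, map_add, smul_add]
      rw [finsum_add_distrib (qzY_finite 𝒱 𝒜 z v s t f (hf.1 v) a)
        (qzY_finite 𝒱 𝒜 z v s t g (hg.1 v) a), hf.2 v a s t, hg.2 v a s t]
  smul_mem' c f hf := by
    refine ⟨fun v => ?_, fun v a s t => ?_⟩
    · obtain ⟨N, h⟩ := hf.1 v
      exact ⟨N, fun n hn => by rw [map_smul, h n hn, smul_zero]⟩
    · simp only [LinearMap.smul_apply, map_smul]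
      rw [← hf.2 v a s t, smul_finsum' c (qzY_finite 𝒱 𝒜 z v s t f (hf.1 v) a)]
      simp only [smul_comm c]

/-- `T'_{Q(z)}(A)`: the sum of all (ordinary) `V`-submodules of the space of compatible
functionals. -/
def tPrime : Submodule ℂ (Module.Dual ℂ A) :=
  sSup {U | U ≤ compatible 𝒱 𝒜 z ∧ ∃ hU : IsStable (qzY 𝒱 𝒜 z) U,
    IsModule 𝒱.toVertexData (restrictY (qzY 𝒱 𝒜 z) U hU)}

theorem tPrime_stable : IsStable (qzY 𝒱 𝒜 z) (tPrime 𝒱 𝒜 z) := by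
  intro v n
  change tPrime 𝒱 𝒜 z ≤ (tPrime 𝒱 𝒜 z).comap (qzY 𝒱 𝒜 z v n)
  refine sSup_le fun U hU => ?_
  obtain ⟨hU1, hU2, hU3⟩ := hU
  exact fun x hx => (le_sSup (show U ∈ _ from ⟨hU1, hU2, hU3⟩) : U ≤ tPrime 𝒱 𝒜 z) (hU2 v n x hx)

/-- The vertex operators on `T'_{Q(z)}(A)`. -/
def tPrimeY : V →ₗ[ℂ] ℤ → Module.End ℂ (tPrime 𝒱 𝒜 z) :=
  restrictY (qzY 𝒱 𝒜 z) (tPrime 𝒱 𝒜 z) (tPrime_stable 𝒱 𝒜 z)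

end Qz

end

noncomputable section

universe uV uW uA

open Finset

/-! ### Binomial coefficients and sums over antidiagonals -/

/-! The completion of W is the dual of W', so a linear map F from A to it amounts to a bilinear
pairing of W' with A, hence to a map g = F^*|_{W'} : W' → A^*. Recovering F from g uses W_(k) =
W_(k)^{**}, i.e. that weight spaces are finite-dimensional. Pairing the identity that defines
intertwining maps with α ∈ W' turns Y^o(v,x₀)F(a) into ⟨g(Y(v,x₀)α), a⟩ (`pairing_contragredientY`).
Its residue in x₁ says that g commutes with V (`dualMap_pairing_contragredientY`); given this, the
full identity is the compatibility identity for every g(α) (`dualMap_pairing_mem_compatible`). The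
same computation read backwards produces F from g (`ofRestrictedDual_mem`).

It remains to see that g takes values in T'. The image g(W') is a stable space of compatible
functionals and a quotient of W', hence a module as soon as W' is one (`IsModule.of_surjective`). So
the substance is that the contragredient W' is a module (`contragredientY_isModule`), and the hard
axiom is the Jacobi identity. It is dual to an identity for Y^o with the products reversed
(`VOA.opp_jacobi_of_mem`). Expanding every Y^o in divided powers of L(1), and moving these through
Y(u,x)v by the conjugation formula (`VOA.divL_mode`), writes that identity as a finite combination
of Jacobi identities on W for the vectors L(1)^a u/a! and L(1)^b v/b!. -/

theorem binom_zero_right (s : ℤ) : binom s 0 = 1 := by simp [binom]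

theorem binom_zero_left (i : ℕ) : binom 0 i = if i = 0 then 1 else 0 := by
  simp [binom, Ring.choose_zero_ite]

theorem binom_succ_succ (s : ℤ) (c : ℕ) :
    binom (s + 1) (c + 1) = binom s c + binom s (c + 1) := by
  simp only [binom, Ring.choose_succ_succ, Int.cast_add]

theorem succ_mul_binom_succ (s : ℤ) (c : ℕ) :
    ((c : ℂ) + 1) * binom s (c + 1) = (s - c) * binom s c := by
  have h := Ring.choose_smul_choose s (Nat.le_succ c)
  rw [Nat.choose_succ_self_right, Nat.succ_sub (le_refl c), Nat.sub_self, Ring.choose_one_right,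
    nsmul_eq_mul] at h
  have h' := congrArg (Int.cast : ℤ → ℂ) h
  push_cast at h'
  simp only [binom]
  rw [mul_comm ((s : ℂ) - c), ← h']

theorem binom_neg (s : ℤ) (c : ℕ) : binom (-s) c = (-1) ^ c * binom (s + c - 1) c := by
  unfold binom
  rw [Ring.choose_neg]
  simp [Int.negOnePow_def, Units.smul_def]

theorem sum_binom_mul_binom (r s : ℤ) (e : ℕ) :
    ∑ q ∈ antidiagonal e, binom r q.1 * binom s q.2 = binom (r + s) e := by
  simp only [binom, Ring.add_choose_eq e (Commute.all r s)]
  push_cast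
  rfl

/-- Negating the top of the second binomial makes it independent of the summation index, so that
Vandermonde applies; a second negation gives the result. -/
theorem sum_neg_one_pow_binom_mul_binom (m R : ℤ) (e : ℕ) :
    ∑ q ∈ antidiagonal e, (-1) ^ q.1 * binom m q.1 * binom (R - q.1) q.2 = binom (R - m) e := by
  have h : ∀ q ∈ antidiagonal e, (-1) ^ q.1 * binom m q.1 * binom (R - q.1) q.2 =
      (-1) ^ e * (binom m q.1 * binom (e - R - 1) q.2) := by
    intro q hq
    rw [HasAntidiagonal.mem_antidiagonal] at hq
    rw [show R - (q.1 : ℤ) = -(q.1 - R) by ring, binom_neg,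
      show (q.1 : ℤ) - R + q.2 - 1 = e - R - 1 by rw [← hq]; push_cast; ring, ← hq, pow_add]
    ring
  rw [sum_congr rfl h, ← mul_sum, sum_binom_mul_binom, show R - m = -(m - R) by ring, binom_neg]
  congr 2
  ring

theorem sum_antidiagonal_swap_inner {M : Type*} [AddCommMonoid M] (f : ℕ → ℕ → ℕ → M) (d : ℕ) :
    ∑ p ∈ antidiagonal d, ∑ q ∈ antidiagonal p.2, f p.1 q.1 q.2 =
      ∑ p ∈ antidiagonal d, ∑ q ∈ antidiagonal p.2, f q.1 p.1 q.2 := by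
  rw [sum_sigma', sum_sigma']
  refine sum_nbij' (fun x => ⟨(x.2.1, x.1.1 + x.2.2), (x.1.1, x.2.2)⟩)
    (fun x => ⟨(x.2.1, x.1.1 + x.2.2), (x.1.1, x.2.2)⟩) ?_ ?_ ?_ ?_ ?_
  · rintro ⟨⟨a, b⟩, ⟨c, d⟩⟩ h
    simp only [mem_sigma, HasAntidiagonal.mem_antidiagonal, and_true] at h ⊢
    omega
  · rintro ⟨⟨a, b⟩, ⟨c, d⟩⟩ h
    simp only [mem_sigma, HasAntidiagonal.mem_antidiagonal, and_true] at h ⊢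
    omega
  · rintro ⟨⟨a, b⟩, ⟨c, d⟩⟩ h
    simp only [mem_sigma, HasAntidiagonal.mem_antidiagonal] at h
    obtain ⟨-, rfl⟩ := h
    rfl
  · rintro ⟨⟨a, b⟩, ⟨c, d⟩⟩ h
    simp only [mem_sigma, HasAntidiagonal.mem_antidiagonal] at h
    obtain ⟨-, rfl⟩ := h
    rfl
  · intro x _
    rfl

/-- The square and the triangle of indices differ only by terms with i + j ≥ N, which vanish. -/
theorem sum_range_sum_range_eq_sum_antidiagonal {M : Type*} [AddCommMonoid M] (g : ℕ → ℕ → M)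
    {N : ℕ} (hN : ∀ i j, N ≤ i + j → g i j = 0) :
    ∑ i ∈ range N, ∑ j ∈ range N, g i j =
      ∑ d ∈ range N, ∑ q ∈ antidiagonal d, g q.1 q.2 := by
  simp only [Nat.sum_antidiagonal_eq_sum_range_succ g]
  rw [sum_range_diag_flip]
  refine sum_congr rfl fun i _ => ?_
  refine (sum_subset (range_mono (Nat.sub_le N i)) fun j _ hj => hN _ _ ?_).symm
  rw [mem_range] at hj
  omega

/-- The sum of `F a b c` over `a + b + c = j`. -/
def tripleSum {M : Type*} [AddCommMonoid M] (F : ℕ → ℕ → ℕ → M) (j : ℕ) : M :=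
  ∑ p ∈ antidiagonal j, ∑ q ∈ antidiagonal p.2, F p.1 q.1 q.2

section TripleSum

variable {M : Type*} [AddCommMonoid M]

theorem tripleSum_congr {F G : ℕ → ℕ → ℕ → M} {j : ℕ}
    (h : ∀ a b c, a + b + c = j → F a b c = G a b c) : tripleSum F j = tripleSum G j := by
  refine sum_congr rfl fun p hp => sum_congr rfl fun q hq => h _ _ _ ?_
  rw [HasAntidiagonal.mem_antidiagonal] at hp hq
  omega

theorem tripleSum_add (F G : ℕ → ℕ → ℕ → M) (j : ℕ) :
    tripleSum (fun a b c => F a b c + G a b c) j = tripleSum F j + tripleSum G j := by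
  simp only [tripleSum, sum_add_distrib]

/-- In the induction for `VOA.divL_mode`, L(1) raises one of three indices. This lemma and its two
companions absorb the shift; the boundary term is killed by a factor equal to that index. -/
theorem tripleSum_succ_fst {F : ℕ → ℕ → ℕ → M} (h : ∀ b c, F 0 b c = 0) (j : ℕ) :
    tripleSum F (j + 1) = tripleSum (fun a b c => F (a + 1) b c) j := by
  simp [tripleSum, Nat.sum_antidiagonal_succ, h]

theorem tripleSum_succ_snd {F : ℕ → ℕ → ℕ → M} (h : ∀ a c, F a 0 c = 0) (j : ℕ) :
    tripleSum F (j + 1) = tripleSum (fun a b c => F a (b + 1) c) j := by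
  simp [tripleSum, Nat.sum_antidiagonal_succ' (n := j), Nat.sum_antidiagonal_succ, h]

theorem tripleSum_succ_thd {F : ℕ → ℕ → ℕ → M} (h : ∀ a b, F a b 0 = 0) (j : ℕ) :
    tripleSum F (j + 1) = tripleSum (fun a b c => F a b (c + 1)) j := by
  simp [tripleSum, Nat.sum_antidiagonal_succ' (n := j), Nat.sum_antidiagonal_succ', h]

theorem sum_range_tripleSum (F : ℕ → ℕ → ℕ → M) {N : ℕ}
    (hN : ∀ a b c, N ≤ a + b + c → F a b c = 0) :
    ∑ a ∈ range N, ∑ b ∈ range N, ∑ c ∈ range N, F a b c = ∑ d ∈ range N, tripleSum F d := by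
  have h : ∀ a, ∑ b ∈ range N, ∑ c ∈ range N, F a b c =
      ∑ r ∈ range N, ∑ q ∈ antidiagonal r, F a q.1 q.2 := fun a =>
    sum_range_sum_range_eq_sum_antidiagonal _ fun b c hbc => hN _ _ _ (by omega)
  simp only [h]
  refine sum_range_sum_range_eq_sum_antidiagonal _ fun a r har => sum_eq_zero fun q hq => hN _ _ _ ?_
  rw [HasAntidiagonal.mem_antidiagonal] at hq
  omega

end TripleSum

/-! ### Conjugation by `e^{xL(1)}` -/

section Conjugation

variable {V : Type uV} [AddCommGroup V] [Module ℂ V]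

theorem finsum_eq_sum_range {M : Type*} [AddCommMonoid M] {f : ℕ → M} {N : ℕ}
    (h : ∀ i, N ≤ i → f i = 0) : ∑ᶠ i, f i = ∑ i ∈ range N, f i := by
  refine finsum_eq_sum_of_support_subset _ fun i hi => ?_
  simp only [coe_range, Set.mem_Iio]
  by_contra hc
  exact hi (h i (by omega))

theorem binom_natCast_eq_zero {n i : ℕ} (h : n < i) : binom n i = 0 := by
  have := Ring.choose_natCast (R := ℤ) n i
  rw [Nat.choose_eq_zero_of_lt h] at this
  simp [binom, this]

/-- `[L(1), u_n] = (L(1)u)_n + (2 wt u - n - 2) u_{n+1}`. -/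
theorem VOA.L_one_mode (𝒱 : VOA V) {p : ℂ} {u : V} (hu : u ∈ 𝒱.wt 𝒱.Y p) (n : ℤ) (v : V) :
    𝒱.L 𝒱.Y 1 (𝒱.Y u n v) =
      𝒱.Y (𝒱.L 𝒱.Y 1 u) n v + 𝒱.Y u n (𝒱.L 𝒱.Y 1 v) + (2 * p - n - 2) • 𝒱.Y u (n + 1) v := by
  have hu' : 𝒱.Y 𝒱.omega 1 u = p • u := by
    simpa [VertexData.wt, VertexData.L, Module.End.mem_eigenspace_iff] using hu
  have hd : 𝒱.Y (𝒱.Y 𝒱.omega 0 u) (n + 2) v = (-((n : ℂ) + 2)) • 𝒱.Y u (n + 1) v := by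
    have := 𝒱.adjoint.derivative u (n + 2) v
    simp only [VertexData.L, neg_add_cancel] at this
    rw [this, show n + 2 - 1 = n + 1 by ring]
    push_cast
    rfl
  -- The commutator formula for ω_2 = L(1): the terms i = 0, 1, 2 involve L(-1)u, L(0)u and L(1)u,
  -- and the first two combine to the scalar 2p - n - 2.
  have hj := 𝒱.adjoint.jacobi 𝒱.omega u v 0 2 n
  rw [finsum_eq_sum_range (N := 3) fun i hi => by
      rw [show (2 : ℤ) = (2 : ℕ) by rfl, binom_natCast_eq_zero (by omega), zero_smul],
    finsum_eq_sum_range (N := 1) fun i hi => by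
      rw [binom_zero_left, if_neg (by omega), mul_zero, zero_smul]] at hj
  have h22 : binom 2 2 = 1 := by
    have := Ring.choose_natCast (R := ℤ) 2 2
    simp only [Nat.cast_ofNat, Nat.choose_self, Nat.cast_one] at this
    simp [binom, this]
  have h21 : binom 2 1 = 2 := by simp [binom]
  simp only [sum_range_succ, sum_range_zero, zero_add, binom_zero_right, h21, h22, one_smul,
    Nat.cast_zero, Nat.cast_one, Nat.cast_ofNat, sub_zero, add_zero, pow_zero, mul_one, zpow_zero,
    hu', map_smul, Pi.smul_apply, LinearMap.smul_apply] at hj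
  rw [show (2 : ℤ) + n = n + 2 by ring, hd, show n + 2 - 1 = n + 1 by ring,
    show n + 2 - 2 = n by ring] at hj
  unfold VertexData.L
  simp only [Int.reduceAdd]
  rw [sub_eq_iff_eq_add.1 hj.symm]
  module

/-- The divided power `L(1)^j / j!`. -/
def VOA.divL (𝒱 : VOA V) (j : ℕ) : Module.End ℂ V := (j.factorial : ℂ)⁻¹ • (𝒱.L 𝒱.Y 1) ^ j

theorem VOA.divL_zero (𝒱 : VOA V) (v : V) : 𝒱.divL 0 v = v := by simp [VOA.divL]

theorem VOA.L_one_divL (𝒱 : VOA V) (j : ℕ) (v : V) :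
    𝒱.L 𝒱.Y 1 (𝒱.divL j v) = ((j : ℂ) + 1) • 𝒱.divL (j + 1) v := by
  simp only [VOA.divL, LinearMap.smul_apply, map_smul, smul_smul, pow_succ', Module.End.mul_apply]
  congr 1
  rw [Nat.factorial_succ]
  push_cast
  have : (j : ℂ) + 1 ≠ 0 := by exact_mod_cast Nat.succ_ne_zero j
  field_simp

theorem VOA.divL_mem (𝒱 : VOA V) {m : ℂ} {v : V} (hv : v ∈ 𝒱.wt 𝒱.Y m) (j : ℕ) :
    𝒱.divL j v ∈ 𝒱.wt 𝒱.Y (m - j) :=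
  Submodule.smul_mem _ _ (𝒱.L_one_pow_mem hv j)

/-- The coefficients of
`e^{xL(1)}Y(u,x₀)e^{-xL(1)} = Y(e^{x(1-xx₀)L(1)}(1-xx₀)^{-2L(0)}u, x₀/(1-xx₀))`. -/
theorem VOA.divL_mode (𝒱 : VOA V) {p : ℤ} {u : V} (hu : u ∈ 𝒱.wt 𝒱.Y (p : ℂ)) (n : ℤ) (v : V)
    (j : ℕ) : 𝒱.divL j (𝒱.Y u n v) = tripleSum (fun a b c =>
      binom (2 * p - a - n - 2) c • 𝒱.Y (𝒱.divL a u) (n + c) (𝒱.divL b v)) j := by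
  induction j with
  | zero => simp [tripleSum, VOA.divL_zero, binom_zero_right]
  | succ j ih =>
    have hne : (j : ℂ) + 1 ≠ 0 := by exact_mod_cast Nat.succ_ne_zero j
    apply smul_right_injective V hne
    simp only
    rw [← 𝒱.L_one_divL, ih]
    set t : ℕ → ℕ → ℕ → V := fun a b c => 𝒱.Y (𝒱.divL a u) (n + c) (𝒱.divL b v) with ht
    -- The three summands of `VOA.L_one_mode` raise a, b and c respectively. After reindexing to
    -- total j + 1, the coefficients must add up to (a + b + c) times the binomial.
    have hL : 𝒱.L 𝒱.Y 1 (tripleSum (fun a b c => binom (2 * p - a - n - 2) c • t a b c) j) =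
        tripleSum (fun a b c => (binom (2 * p - a - n - 2) c * (a + 1)) • t (a + 1) b c) j +
        tripleSum (fun a b c => (binom (2 * p - a - n - 2) c * (b + 1)) • t a (b + 1) c) j +
        tripleSum (fun a b c =>
          (binom (2 * p - a - n - 2) c * (2 * (p - a) - (n + c) - 2)) • t a b (c + 1)) j := by
      rw [← tripleSum_add, ← tripleSum_add]
      simp only [tripleSum, map_sum]
      refine sum_congr rfl fun x _ => sum_congr rfl fun y _ => ?_
      rw [map_smul, ht]
      simp only
      rw [𝒱.L_one_mode (𝒱.divL_mem hu _), 𝒱.L_one_divL, 𝒱.L_one_divL]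
      simp only [map_smul, Pi.smul_apply, LinearMap.smul_apply, smul_add, smul_smul]
      push_cast
      rw [add_assoc n]
    have h1 : tripleSum (fun a b c => (binom (2 * p - a - n - 2) c * (a + 1)) • t (a + 1) b c) j =
        tripleSum (fun a b c => (binom (2 * p - a + 1 - n - 2) c * a) • t a b c) (j + 1) := by
      rw [tripleSum_succ_fst (by simp)]
      refine tripleSum_congr fun a b c _ => ?_
      push_cast
      congr 3
      ring
    have h2 : tripleSum (fun a b c => (binom (2 * p - a - n - 2) c * (b + 1)) • t a (b + 1) c) j =
        tripleSum (fun a b c => (binom (2 * p - a - n - 2) c * b) • t a b c) (j + 1) := by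
      rw [tripleSum_succ_snd (by simp)]
      refine tripleSum_congr fun a b c _ => ?_
      push_cast
      rfl
    -- With s = 2p - a - n - 2 the scalar is (s - c) - a. The part s - c is absorbed by
    -- `succ_mul_binom_succ`; the part -a is rewritten by Pascal's rule so as to cancel the top s +
    -- 1 that lowering a created in `h1`.
    have h3 : tripleSum (fun a b c =>
          (binom (2 * p - a - n - 2) c * (2 * (p - a) - (n + c) - 2)) • t a b (c + 1)) j =
        tripleSum (fun a b c => (c * binom (2 * p - a - n - 2) c -
          a * (binom (2 * p - a + 1 - n - 2) c - binom (2 * p - a - n - 2) c)) • t a b c)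
          (j + 1) := by
      rw [tripleSum_succ_thd (by simp [binom_zero_right])]
      refine tripleSum_congr fun a b c _ => ?_
      rw [show 2 * p - a + 1 - n - 2 = 2 * p - a - n - 2 + 1 by ring, binom_succ_succ]
      push_cast
      rw [succ_mul_binom_succ]
      push_cast
      congr 1
      ring
    rw [hL, h1, h2, h3, ← tripleSum_add, ← tripleSum_add]
    simp only [tripleSum, smul_sum]
    refine sum_congr rfl fun x hx => sum_congr rfl fun y hy => ?_
    rw [HasAntidiagonal.mem_antidiagonal] at hx hy
    have hj : (j : ℂ) + 1 = x.1 + y.1 + y.2 := by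
      rw [← Nat.cast_add_one, ← hx, ← hy]
      push_cast
      ring
    rw [← add_smul, ← add_smul, smul_smul, hj]
    congr 1
    ring

/-- After expansion by `VOA.divL_mode`, the terms with fixed a, b and fixed e = i + c share the same
vector, and `sum_neg_one_pow_binom_mul_binom` sums their coefficients. The result has the shape of
the iterate side of a Jacobi identity with m replaced by 2p - m - l - 2 - a. -/
theorem VOA.sum_antidiagonal_divL_mode (𝒱 : VOA V) {p : ℤ} {u : V} (hu : u ∈ 𝒱.wt 𝒱.Y (p : ℂ))
    (l m : ℤ) (v : V) (d : ℕ) :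
    ∑ q ∈ antidiagonal d, ((-1) ^ q.1 * binom m q.1) • 𝒱.divL q.2 (𝒱.Y u (l + q.1) v) =
      tripleSum (fun a b e => binom (2 * p - m - l - 2 - a) e •
        𝒱.Y (𝒱.divL a u) (l + e) (𝒱.divL b v)) d := by
  simp only [𝒱.divL_mode hu, tripleSum, smul_sum, smul_smul]
  rw [sum_antidiagonal_swap_inner (fun i a r => ∑ q ∈ antidiagonal r,
    ((-1) ^ i * binom m i * binom (2 * p - a - (l + i) - 2) q.2) •
      𝒱.Y (𝒱.divL a u) (l + i + q.2) (𝒱.divL q.1 v))]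
  refine sum_congr rfl fun x _ => ?_
  rw [sum_antidiagonal_swap_inner (fun i b c =>
    ((-1) ^ i * binom m i * binom (2 * p - x.1 - (l + i) - 2) c) •
      𝒱.Y (𝒱.divL x.1 u) (l + i + c) (𝒱.divL b v))]
  refine sum_congr rfl fun y _ => ?_
  rw [show 2 * p - m - l - 2 - x.1 = (2 * p - x.1 - l - 2) - m by ring,
    ← sum_neg_one_pow_binom_mul_binom, sum_smul]
  refine sum_congr rfl fun q hq => ?_
  rw [HasAntidiagonal.mem_antidiagonal] at hq
  rw [← hq]
  push_cast
  rw [add_assoc l, show 2 * p - x.1 - (l + (q.1 : ℤ)) - 2 = 2 * p - x.1 - l - 2 - q.1 by ring]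

end Conjugation

/-! ### The Jacobi identity for the opposite vertex operators -/

theorem eigenProj_of_mem_self {M : Type*} [AddCommGroup M] [Module ℂ M] {T : Module.End ℂ M}
    (hT : ⨆ h : ℂ, Module.End.eigenspace T h = ⊤) {k : ℂ} {w : M}
    (hw : w ∈ Module.End.eigenspace T k) : (eigenProj T k w : M) = w := by
  have H := isInternal_eigenspace hT
  have e : (LinearEquiv.ofBijective
      (DirectSum.coeLinearMap fun k : ℂ => Module.End.eigenspace T k) H).symm w
      = DirectSum.lof ℂ ℂ (fun k : ℂ => Module.End.eigenspace T k) k ⟨w, hw⟩ := by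
    rw [LinearEquiv.symm_apply_eq]
    exact (DirectSum.coeLinearMap_lof (fun k : ℂ => Module.End.eigenspace T k) k
      (⟨w, hw⟩ : Module.End.eigenspace T k)).symm
  rw [eigenProj_apply H, e]
  rw [DirectSum.lof_apply]

section OppositeJacobi

variable {V : Type uV} [AddCommGroup V] [Module ℂ V]
variable {M : Type uW} [AddCommGroup M] [Module ℂ M]

theorem VOA.iSup_wt (𝒱 : VOA V) : ⨆ h : ℂ, 𝒱.wt 𝒱.Y h = ⊤ :=
  top_le_iff.1 (𝒱.graded.symm.le.trans (iSup_le fun n => le_iSup (𝒱.wt 𝒱.Y) (n : ℂ)))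

theorem VOA.oppTerm_of_mem (𝒱 : VOA V) {q : ℤ} {v : V} (hv : v ∈ 𝒱.wt 𝒱.Y (q : ℂ)) (j : ℕ) :
    𝒱.oppTerm (q, j) v = ((𝒱.L 𝒱.Y 1) ^ j) v := by
  change ((𝒱.L 𝒱.Y 1) ^ j) (eigenProj (𝒱.L 𝒱.Y 0) (q : ℂ) v : V) = _
  rw [eigenProj_of_mem_self 𝒱.iSup_wt hv]

theorem VOA.oppTerm_of_mem_of_ne (𝒱 : VOA V) {q : ℤ} {v : V} (hv : v ∈ 𝒱.wt 𝒱.Y (q : ℂ))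
    {p : ℤ × ℕ} (hp : p.1 ≠ q) : 𝒱.oppTerm p v = 0 := by
  change ((𝒱.L 𝒱.Y 1) ^ p.2) (eigenProj (𝒱.L 𝒱.Y 0) (p.1 : ℂ) v : V) = _
  rw [eigenProj_of_mem 𝒱.iSup_wt hv (by exact_mod_cast hp)]
  simp

theorem VOA.opp_apply_of_mem (𝒱 : VOA V) (Y : V →ₗ[ℂ] ℤ → Module.End ℂ M) {q : ℤ} {v : V}
    (hv : v ∈ 𝒱.wt 𝒱.Y (q : ℂ)) {N : ℕ} (hN : ∀ j, N ≤ j → 𝒱.divL j v = 0) (n : ℤ) (w : M) :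
    𝒱.opp Y v n w =
      ∑ j ∈ range N, ((-1 : ℂ) ^ q) • Y (𝒱.divL j v) (2 * q - n - 2 - j) w := by
  have hdiv : ∀ j, ((-1 : ℂ) ^ q) • Y (𝒱.divL j v) (2 * q - n - 2 - j) w =
      ((-1 : ℂ) ^ q / (j.factorial : ℂ)) • Y (𝒱.oppTerm (q, j) v) (2 * q - n - 2 - j) w := by
    intro j
    rw [𝒱.oppTerm_of_mem hv, VOA.divL]
    simp only [LinearMap.smul_apply, map_smul, Pi.smul_apply, smul_smul, div_eq_mul_inv]
  rw [𝒱.opp_apply, sum_congr rfl fun j _ => hdiv j]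
  refine Eq.trans ?_ (sum_map (range N) ⟨fun j : ℕ => ((q, j) : ℤ × ℕ), Prod.mk_right_injective q⟩
    fun p : ℤ × ℕ => ((-1 : ℂ) ^ p.1 / (p.2.factorial : ℂ)) •
      Y (𝒱.oppTerm p v) (2 * p.1 - n - 2 - p.2) w)
  rw [← finsum_eq_sum_of_support_subset, ← finsum_eq_sum_of_support_subset]
  · rintro ⟨p, j⟩ hp
    rw [Function.mem_support] at hp
    have hpq : p = q := by
      by_contra hne
      exact hp (by rw [𝒱.oppTerm_of_mem_of_ne hv hne]; simp)
    subst hpq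
    simp only [coe_map, Function.Embedding.coeFn_mk, Set.mem_image, coe_range, Set.mem_Iio]
    refine ⟨j, ?_, rfl⟩
    by_contra hj
    exact hp (by rw [← hdiv, hN j (by omega)]; simp)
  · intro p hp
    rw [Set.Finite.coe_toFinset]
    intro h0
    have h0' : 𝒱.oppTerm p v = 0 := h0
    exact hp (by simp [h0'])

theorem VOA.exists_wt_eq_bot (𝒱 : VOA V) (k : ℤ) :
    ∃ D : ℕ, ∀ d : ℕ, D ≤ d → 𝒱.wt 𝒱.Y ((k : ℂ) - d) = ⊥ := by
  obtain ⟨N, hN⟩ := 𝒱.lower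
  refine ⟨(k - N + 1).toNat, fun d hd => ?_⟩
  have := hN (k - d) (by omega)
  push_cast at this
  exact this

theorem finsum_eq_sum_range_eventually {N₀ : Type*} [AddCommMonoid N₀] {f : ℕ → N₀}
    (h : ∀ᶠ i in Filter.atTop, f i = 0) :
    ∀ᶠ N in Filter.atTop, ∑ᶠ i, f i = ∑ i ∈ range N, f i := by
  obtain ⟨N₁, h⟩ := Filter.eventually_atTop.1 h
  filter_upwards [Filter.eventually_ge_atTop N₁] with N hN
  exact finsum_eq_sum_range fun i hi => h i (hN.trans hi)

/-- Cutting both sides at one common large N gives ordinary finite sums, through which linear maps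
can be passed term by term. -/
theorem VertexData.finsum_jacobi_eventually (D : VertexData V) {Y : V →ₗ[ℂ] ℤ → Module.End ℂ M}
    (hY : ∀ (v : V) (w : M), ∃ N : ℤ, ∀ n, N ≤ n → Y v n w = 0) (u v : V) (w : M) (l m n : ℤ) :
    ∀ᶠ N in Filter.atTop,
      ∑ᶠ i : ℕ, binom m i • Y (D.Y u (l + i) v) (m + n - i) w =
          ∑ i ∈ range N, binom m i • Y (D.Y u (l + i) v) (m + n - i) w ∧
      ∑ᶠ i : ℕ, ((-1) ^ i * binom l i) •
          (Y u (m + l - i) (Y v (n + i) w) - ((-1 : ℂ) ^ l) • Y v (n + l - i) (Y u (m + i) w)) =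
        ∑ i ∈ range N, ((-1) ^ i * binom l i) •
          (Y u (m + l - i) (Y v (n + i) w) -
            ((-1 : ℂ) ^ l) • Y v (n + l - i) (Y u (m + i) w)) := by
  refine (finsum_eq_sum_range_eventually ?_).and (finsum_eq_sum_range_eventually ?_)
  · obtain ⟨N, hN⟩ := D.truncation u v
    filter_upwards [Filter.eventually_ge_atTop (N - l).toNat] with i hi
    rw [hN _ (by omega)]
    simp
  · obtain ⟨N₁, hN₁⟩ := hY v w
    obtain ⟨N₂, hN₂⟩ := hY u w
    filter_upwards [Filter.eventually_ge_atTop (N₁ - n).toNat,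
      Filter.eventually_ge_atTop (N₂ - m).toNat] with i hi hi'
    rw [hN₁ _ (by omega), hN₂ _ (by omega)]
    simp

theorem IsWeakModule.jacobi_eventually {D : VertexData V} {Y : V →ₗ[ℂ] ℤ → Module.End ℂ M}
    (hY : IsWeakModule D Y) (u v : V) (w : M) (l m n : ℤ) :
    ∀ᶠ N in Filter.atTop,
      ∑ i ∈ range N, binom m i • Y (D.Y u (l + i) v) (m + n - i) w =
        ∑ i ∈ range N, ((-1) ^ i * binom l i) •
          (Y u (m + l - i) (Y v (n + i) w) -
            ((-1 : ℂ) ^ l) • Y v (n + l - i) (Y u (m + i) w)) := by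
  filter_upwards [D.finsum_jacobi_eventually hY.truncation u v w l m n] with N e
  rw [← e.1, ← e.2]
  exact hY.jacobi u v w l m n

/-- Write m' = 2p - m - l - 2 - a and n' = 2q - n - l - 2 - b. Up to one common sign, both sides are
sums over a, b of the two sides of the Jacobi identity on M for `divL a u`, `divL b v` and the
exponents l, m', n'. The iterate side comes from `VOA.sum_antidiagonal_divL_mode`, the product side
from expanding each opposite operator. -/
theorem VOA.opp_jacobi_of_mem (𝒱 : VOA V) {Y : V →ₗ[ℂ] ℤ → Module.End ℂ M}
    (hY : IsWeakModule 𝒱.toVertexData Y) {p q : ℤ} {u v : V} (hu : u ∈ 𝒱.wt 𝒱.Y (p : ℂ))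
    (hv : v ∈ 𝒱.wt 𝒱.Y (q : ℂ)) (w : M) (l m n : ℤ) :
    ∀ᶠ N in Filter.atTop,
      ∑ i ∈ range N, binom m i • 𝒱.opp Y (𝒱.Y u (l + i) v) (m + n - i) w =
        ∑ i ∈ range N, ((-1) ^ i * binom l i) •
          (𝒱.opp Y v (n + i) (𝒱.opp Y u (m + l - i) w) -
            ((-1 : ℂ) ^ l) • 𝒱.opp Y u (m + i) (𝒱.opp Y v (n + l - i) w)) := by
  -- The vectors L(1)^j(u_{l+i}v) and (L(1)^a u)_{l+e}(L(1)^b v) have weight p + q - l - 1 - d, with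
  -- d = i + j or d = a + b + e. One bound D on d therefore serves both sides.
  obtain ⟨D, hD⟩ := 𝒱.exists_wt_eq_bot (p + q - l - 1)
  obtain ⟨A₁, hA₁⟩ := 𝒱.exists_wt_eq_bot p
  obtain ⟨A₂, hA₂⟩ := 𝒱.exists_wt_eq_bot q
  have hu0 : ∀ a, A₁ ≤ a → 𝒱.divL a u = 0 := fun a ha => by
    have := 𝒱.divL_mem hu a
    rwa [hA₁ a ha, Submodule.mem_bot] at this
  have hv0 : ∀ a, A₂ ≤ a → 𝒱.divL a v = 0 := fun a ha => by
    have := 𝒱.divL_mem hv a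
    rwa [hA₂ a ha, Submodule.mem_bot] at this
  -- Only finitely many pairs (a, b) give nonzero vectors, so one N works for all their Jacobi
  -- identities.
  have hJ : ∀ᶠ N in Filter.atTop, ∀ a ∈ range A₁, ∀ b ∈ range A₂, _ :=
    (Filter.eventually_all_finset (range A₁)).2 fun a _ =>
      (Filter.eventually_all_finset (range A₂)).2 fun b _ =>
        hY.jacobi_eventually (𝒱.divL a u) (𝒱.divL b v) w l (2 * p - m - l - 2 - a)
          (2 * q - n - l - 2 - b)
  filter_upwards [hJ, Filter.eventually_ge_atTop D, Filter.eventually_ge_atTop A₁,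
    Filter.eventually_ge_atTop A₂] with N hJ hND hN₁ hN₂
  have hsq : ((-1 : ℂ) ^ l) * (-1 : ℂ) ^ l = 1 := by
    rw [← mul_zpow]
    simp
  -- K - a - b is the sum of the two exponents m', n' attached to a and b. The sign c is that of the
  -- weight p + q - l - i - 1 of u_{l+i}v, without its factor (-1)^i, which stays inside the sum.
  set K : ℤ := 2 * p + 2 * q - 2 * l - m - n - 4 with hK
  set c : ℂ := -((-1 : ℂ) ^ p * (-1 : ℂ) ^ q * (-1 : ℂ) ^ l) with hc
  have hL : ∑ i ∈ range N, binom m i • 𝒱.opp Y (𝒱.Y u (l + i) v) (m + n - i) w =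
      c • ∑ d ∈ range N, Y (∑ x ∈ antidiagonal d,
        ((-1) ^ x.1 * binom m x.1) • 𝒱.divL x.2 (𝒱.Y u (l + x.1) v)) (K - d) w := by
    have hmem : ∀ i : ℕ, 𝒱.Y u (l + i) v ∈ 𝒱.wt 𝒱.Y ((p + q - l - i - 1 : ℤ) : ℂ) := fun i => by
      have := 𝒱.adjoint.mode_mem hu hv (l + i)
      convert this using 2
      push_cast
      ring
    have hzero : ∀ i j : ℕ, N ≤ i + j → 𝒱.divL j (𝒱.Y u (l + i) v) = 0 := fun i j hij => by
      have h1 := 𝒱.divL_mem (hmem i) j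
      have h2 := hD (i + j) (hND.trans hij)
      rw [show ((p + q - l - i - 1 : ℤ) : ℂ) - j = ((p + q - l - 1 : ℤ) : ℂ) - (i + j : ℕ) by
        push_cast; ring, h2, Submodule.mem_bot] at h1
      exact h1
    have hinner : ∀ d ∈ range N, Y (∑ x ∈ antidiagonal d,
        ((-1) ^ x.1 * binom m x.1) • 𝒱.divL x.2 (𝒱.Y u (l + x.1) v)) (K - d) w =
        ∑ x ∈ antidiagonal d, ((-1) ^ x.1 * binom m x.1) •
          Y (𝒱.divL x.2 (𝒱.Y u (l + x.1) v)) (K - (x.1 + x.2)) w := fun d _ => by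
      simp only [map_sum, map_smul, Finset.sum_apply, LinearMap.sum_apply, Pi.smul_apply,
        LinearMap.smul_apply]
      refine sum_congr rfl fun x hx => ?_
      rw [HasAntidiagonal.mem_antidiagonal] at hx
      rw [← hx]
      push_cast
      rfl
    rw [sum_congr rfl hinner, ← sum_range_sum_range_eq_sum_antidiagonal
      (fun i j => ((-1) ^ i * binom m i) •
          Y (𝒱.divL j (𝒱.Y u (l + i) v)) (K - (i + j)) w)
      (fun i j hij => by rw [hzero i j hij]; simp)]
    simp only [smul_sum]
    refine sum_congr rfl fun i _ => ?_
    rw [𝒱.opp_apply_of_mem Y (hmem i) (N := N) (fun j hj => hzero i j (by omega)), smul_sum]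
    refine sum_congr rfl fun j _ => ?_
    rw [smul_smul, smul_smul]
    congr 1
    · have h1 : (-1 : ℂ) ^ (p + q - l - i - 1) =
          (-1 : ℂ) ^ p * (-1 : ℂ) ^ q * (-1 : ℂ) ^ l * (-1) ^ i * (-1) := by
        have hne : (-1 : ℂ) ≠ 0 := by norm_num
        rw [zpow_sub₀ hne, zpow_sub₀ hne, zpow_sub₀ hne, zpow_add₀ hne, zpow_one, zpow_natCast]
        have h2 : ((-1 : ℂ) ^ l)⁻¹ = (-1 : ℂ) ^ l := inv_eq_of_mul_eq_one_left hsq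
        have h3 : (((-1 : ℂ) ^ i))⁻¹ = (-1 : ℂ) ^ i := inv_eq_of_mul_eq_one_left (by
          rw [← mul_pow]; simp)
        rw [div_eq_mul_inv, div_eq_mul_inv, div_eq_mul_inv, h2, h3]
        norm_num
      rw [h1, hc]
      ring
    · rw [show 2 * (p + q - l - (i : ℤ) - 1) - (m + n - i) - 2 - j = K - (i + j) by rw [hK]; ring]
  have hR : ∑ i ∈ range N, ((-1) ^ i * binom l i) •
      (𝒱.opp Y v (n + i) (𝒱.opp Y u (m + l - i) w) -
        ((-1 : ℂ) ^ l) • 𝒱.opp Y u (m + i) (𝒱.opp Y v (n + l - i) w)) =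
      c • ∑ d ∈ range N, Y (tripleSum (fun a b e => binom (2 * p - m - l - 2 - a) e •
        𝒱.Y (𝒱.divL a u) (l + e) (𝒱.divL b v)) d) (K - d) w := by
    have hzero : ∀ a b e : ℕ, N ≤ a + b + e →
        𝒱.Y (𝒱.divL a u) (l + e) (𝒱.divL b v) = 0 := fun a b e h => by
      have h1 := 𝒱.adjoint.mode_mem (𝒱.divL_mem hu a) (𝒱.divL_mem hv b) (l + e)
      have h2 := hD (a + b + e) (hND.trans h)
      rw [show (q : ℂ) - b + (p - a) - ((l + e : ℤ) : ℂ) - 1 =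
        ((p + q - l - 1 : ℤ) : ℂ) - (a + b + e : ℕ) by push_cast; ring, h2,
        Submodule.mem_bot] at h1
      exact h1
    have hinner : ∀ d ∈ range N, Y (tripleSum (fun a b e => binom (2 * p - m - l - 2 - a) e •
        𝒱.Y (𝒱.divL a u) (l + e) (𝒱.divL b v)) d) (K - d) w =
        tripleSum (fun a b e => binom (2 * p - m - l - 2 - a) e •
          Y (𝒱.Y (𝒱.divL a u) (l + e) (𝒱.divL b v)) (K - (a + b + e)) w) d := fun d _ => by
      simp only [tripleSum, map_sum, map_smul, Finset.sum_apply, LinearMap.sum_apply,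
        Pi.smul_apply, LinearMap.smul_apply]
      refine sum_congr rfl fun x hx => sum_congr rfl fun y hy => ?_
      rw [HasAntidiagonal.mem_antidiagonal] at hx hy
      rw [← hx, ← hy]
      push_cast
      rw [add_assoc (x.1 : ℤ)]
    rw [sum_congr rfl hinner, ← sum_range_tripleSum _
      (fun a b e h => by rw [hzero a b e h]; simp)]
    have hterm : ∀ i ∈ range N, ((-1) ^ i * binom l i) •
        (𝒱.opp Y v (n + i) (𝒱.opp Y u (m + l - i) w) -
          ((-1 : ℂ) ^ l) • 𝒱.opp Y u (m + i) (𝒱.opp Y v (n + l - i) w)) =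
        ∑ a ∈ range N, ∑ b ∈ range N, c • (((-1) ^ i * binom l i) •
          (Y (𝒱.divL a u) ((2 * p - m - l - 2 - a) + l - i)
              (Y (𝒱.divL b v) ((2 * q - n - l - 2 - b) + i) w) -
            ((-1 : ℂ) ^ l) • Y (𝒱.divL b v) ((2 * q - n - l - 2 - b) + l - i)
              (Y (𝒱.divL a u) ((2 * p - m - l - 2 - a) + i) w))) := fun i _ => by
      simp only [𝒱.opp_apply_of_mem Y hu fun j hj => hu0 j (hN₁.trans hj),
        𝒱.opp_apply_of_mem Y hv fun j hj => hv0 j (hN₂.trans hj), map_sum, map_smul, smul_sum]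
      rw [sum_comm, ← sum_sub_distrib, smul_sum]
      refine sum_congr rfl fun a _ => ?_
      rw [← sum_sub_distrib, smul_sum]
      refine sum_congr rfl fun b _ => ?_
      -- Passing to opposite modes makes the two products trade places: the one in which v acts last
      -- becomes the subtracted term of the Jacobi identity. The signs agree because (-1)^l squares
      -- to 1.
      rw [show 2 * q - (n + (i : ℤ)) - 2 - b = (2 * q - n - l - 2 - b) + l - i by ring,
        show 2 * p - (m + l - (i : ℤ)) - 2 - a = (2 * p - m - l - 2 - a) + i by ring,
        show 2 * p - (m + (i : ℤ)) - 2 - a = (2 * p - m - l - 2 - a) + l - i by ring,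
        show 2 * q - (n + l - (i : ℤ)) - 2 - b = (2 * q - n - l - 2 - b) + i by ring]
      generalize Y (𝒱.divL b v) (2 * q - n - l - 2 - b + l - i) _ = x
      generalize Y (𝒱.divL a u) (2 * p - m - l - 2 - a + l - i) _ = y
      simp only [smul_sub, smul_smul, hc]
      rw [sub_eq_neg_add, sub_eq_add_neg, ← neg_smul, ← neg_smul]
      congr 2
      · ring
      · linear_combination (-((-1 : ℂ) ^ i * binom l i * ((-1) ^ p * (-1) ^ q))) * hsq
    rw [sum_congr rfl hterm, sum_comm, smul_sum]
    refine sum_congr rfl fun a _ => ?_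
    rw [sum_comm, smul_sum]
    refine sum_congr rfl fun b _ => ?_
    rw [← smul_sum]
    congr 1
    by_cases ha : a < A₁
    · by_cases hb : b < A₂
      · rw [← hJ a (mem_range.2 ha) b (mem_range.2 hb)]
        refine sum_congr rfl fun i _ => ?_
        rw [show 2 * p - m - l - 2 - (a : ℤ) + (2 * q - n - l - 2 - b) - i = K - (a + b + i) by
          rw [hK]; ring]
      · simp [hv0 b (by omega)]
    · simp [hu0 a (by omega)]
  rw [hL, hR]
  simp only [𝒱.sum_antidiagonal_divL_mode hu]

/-- Both sides are biadditive in u and v for each N, and two eventual statements hold together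
eventually, so homogeneous u and v suffice. -/
theorem VOA.opp_jacobi_eventually (𝒱 : VOA V) {Y : V →ₗ[ℂ] ℤ → Module.End ℂ M}
    (hY : IsWeakModule 𝒱.toVertexData Y) (u v : V) (w : M) (l m n : ℤ) :
    ∀ᶠ N in Filter.atTop,
      ∑ i ∈ range N, binom m i • 𝒱.opp Y (𝒱.Y u (l + i) v) (m + n - i) w =
        ∑ i ∈ range N, ((-1) ^ i * binom l i) •
          (𝒱.opp Y v (n + i) (𝒱.opp Y u (m + l - i) w) -
            ((-1 : ℂ) ^ l) • 𝒱.opp Y u (m + i) (𝒱.opp Y v (n + l - i) w)) := by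
  have hu : u ∈ ⨆ p : ℤ, 𝒱.wt 𝒱.Y (p : ℂ) := by rw [𝒱.graded]; trivial
  have hv : v ∈ ⨆ p : ℤ, 𝒱.wt 𝒱.Y (p : ℂ) := by rw [𝒱.graded]; trivial
  induction hu using Submodule.iSup_induction' with
  | zero => simp
  | add x y _ _ hx hy =>
    filter_upwards [hx, hy] with N hx hy
    simp only [map_add, Pi.add_apply, LinearMap.add_apply, smul_add, sum_add_distrib, hx, hy]
    rw [← sum_add_distrib]
    refine sum_congr rfl fun i _ => ?_
    module
  | mem p u hu =>
    induction hv using Submodule.iSup_induction' with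
    | zero => simp
    | add x y _ _ hx hy =>
      filter_upwards [hx, hy] with N hx hy
      simp only [map_add, Pi.add_apply, LinearMap.add_apply, smul_add, sum_add_distrib, hx, hy]
      rw [← sum_add_distrib]
      refine sum_congr rfl fun i _ => ?_
      module
    | mem q v hv => exact 𝒱.opp_jacobi_of_mem hY hu hv w l m n

end OppositeJacobi

/-! ### The contragredient module -/

theorem linearMap_eq_of_eqOn_eigenspaces {M N : Type*} [AddCommGroup M] [Module ℂ M]
    [AddCommGroup N] [Module ℂ N] {T : Module.End ℂ M}
    (hT : ⨆ h : ℂ, Module.End.eigenspace T h = ⊤) {φ ψ : M →ₗ[ℂ] N}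
    (h : ∀ k : ℂ, ∀ w ∈ Module.End.eigenspace T k, φ w = ψ w) : φ = ψ := by
  have h' : (⨆ h : ℂ, Module.End.eigenspace T h) ≤ LinearMap.eqLocus φ ψ :=
    iSup_le fun k w hw => h k w hw
  rw [hT] at h'
  exact LinearMap.ext fun w => h' (Submodule.mem_top (x := w))

/-! ### Opposite operators of the vacuum and of ω, and the derivative property -/

section Vacuum

variable {V : Type uV} [AddCommGroup V] [Module ℂ V]
variable {M : Type uW} [AddCommGroup M] [Module ℂ M]

theorem VOA.L_vac (𝒱 : VOA V) {n : ℤ} (hn : -1 ≤ n) : 𝒱.L 𝒱.Y n 𝒱.vac = 0 :=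
  𝒱.creation _ _ (by omega)

theorem VOA.L_neg_two_vac (𝒱 : VOA V) : 𝒱.L 𝒱.Y (-2) 𝒱.vac = 𝒱.omega := 𝒱.creation' 𝒱.omega

theorem VOA.vac_mem (𝒱 : VOA V) : 𝒱.vac ∈ 𝒱.wt 𝒱.Y ((0 : ℤ) : ℂ) := by
  rw [VertexData.wt, Module.End.mem_eigenspace_iff, 𝒱.L_vac (by norm_num)]
  simp

theorem VOA.omega_mem (𝒱 : VOA V) : 𝒱.omega ∈ 𝒱.wt 𝒱.Y ((2 : ℤ) : ℂ) := by
  have h := 𝒱.adjoint.virasoro 0 (-2) 𝒱.vac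
  rw [𝒱.L_neg_two_vac, 𝒱.L_vac (by norm_num)] at h
  rw [VertexData.wt, Module.End.mem_eigenspace_iff]
  simpa [𝒱.L_neg_two_vac] using h

/-- L(1)L(-2)𝟏 = 3L(-1)𝟏 = 0. Hence Y^o(ω,x) has no correction terms, and passing to the opposite
exchanges L(n) and L(-n). -/
theorem VOA.L_one_omega (𝒱 : VOA V) : 𝒱.L 𝒱.Y 1 𝒱.omega = 0 := by
  have h := 𝒱.adjoint.virasoro 1 (-2) 𝒱.vac
  rw [𝒱.L_neg_two_vac, 𝒱.L_vac (by norm_num)] at h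
  simpa [𝒱.L_vac] using h

theorem VOA.divL_eq_zero_of_L_one_eq_zero (𝒱 : VOA V) {v : V} (hv : 𝒱.L 𝒱.Y 1 v = 0) {j : ℕ}
    (hj : 1 ≤ j) : 𝒱.divL j v = 0 := by
  obtain ⟨j, rfl⟩ := Nat.exists_eq_add_of_le' hj
  simp [VOA.divL, pow_succ, hv]

/-- The opposite vertex operators of quasi-primary vectors. -/
theorem VOA.opp_of_L_one_eq_zero (𝒱 : VOA V) (Y : V →ₗ[ℂ] ℤ → Module.End ℂ M) {q : ℤ} {v : V}
    (hv : v ∈ 𝒱.wt 𝒱.Y (q : ℂ)) (hv1 : 𝒱.L 𝒱.Y 1 v = 0) (n : ℤ) (w : M) :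
    𝒱.opp Y v n w = ((-1 : ℂ) ^ q) • Y v (2 * q - n - 2) w := by
  rw [𝒱.opp_apply_of_mem Y hv (N := 1) fun j hj => 𝒱.divL_eq_zero_of_L_one_eq_zero hv1 hj]
  simp [VOA.divL_zero]

theorem VOA.opp_vac (𝒱 : VOA V) (Y : V →ₗ[ℂ] ℤ → Module.End ℂ M) (n : ℤ) (w : M) :
    𝒱.opp Y 𝒱.vac n w = Y 𝒱.vac (-n - 2) w := by
  rw [𝒱.opp_of_L_one_eq_zero Y 𝒱.vac_mem (𝒱.L_vac (by norm_num))]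
  simp

theorem VOA.opp_omega (𝒱 : VOA V) (Y : V →ₗ[ℂ] ℤ → Module.End ℂ M) (n : ℤ) (w : M) :
    𝒱.opp Y 𝒱.omega (n + 1) w = 𝒱.L Y (-n) w := by
  rw [𝒱.opp_of_L_one_eq_zero Y 𝒱.omega_mem 𝒱.L_one_omega, VertexData.L,
    show 2 * 2 - (n + 1) - 2 = -n + 1 by ring]
  norm_num

theorem binom_neg_two (i : ℕ) : (-1) ^ i * binom (-2) i = i + 1 := by
  rw [binom_neg, ← mul_assoc, ← mul_pow]
  have h := Ring.choose_natCast (R := ℤ) (i + 1) i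
  rw [Nat.choose_succ_self_right] at h
  rw [show (2 : ℤ) + i - 1 = (i + 1 : ℕ) by push_cast; ring, binom, h]
  simp

/-- The `L(-1)`-derivative property follows from the Jacobi identity and the vacuum property. -/
theorem VOA.derivative_of_jacobi (𝒱 : VOA V) {Y : V →ₗ[ℂ] ℤ → Module.End ℂ M}
    (vacuum : ∀ (n : ℤ) (w : M), Y 𝒱.vac n w = if n = -1 then w else 0)
    (jacobi : ∀ (u v : V) (w : M) (l m n : ℤ),
      ∑ᶠ i : ℕ, binom m i • Y (𝒱.Y u (l + i) v) (m + n - i) w =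
        ∑ᶠ i : ℕ, ((-1) ^ i * binom l i) •
          (Y u (m + l - i) (Y v (n + i) w) - ((-1 : ℂ) ^ l) • Y v (n + l - i) (Y u (m + i) w)))
    (v : V) (n : ℤ) (w : M) : Y (𝒱.L 𝒱.Y (-1) v) n w = (-(n : ℂ)) • Y v (n - 1) w := by
  have hL : 𝒱.L 𝒱.Y (-1) v = 𝒱.Y v (-2) 𝒱.vac := by
    have := 𝒱.adjoint.derivative v (-1) 𝒱.vac
    rw [𝒱.creation'] at this
    simpa using this
  -- With m = 0 the left side is the single term (v_{-2}𝟏)_n = (L(-1)v)_n.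
  have hj := jacobi v 𝒱.vac w (-2) 0 n
  rw [finsum_eq_sum_range (N := 1) fun i hi => by
    rw [binom_zero_left, if_neg (by omega), zero_smul]] at hj
  simp only [sum_range_one, binom_zero_right, one_smul, Nat.cast_zero, add_zero, zero_add, sub_zero,
    ← hL, binom_neg_two, vacuum] at hj
  rw [hj]
  have h2 : (-1 : ℂ) ^ (-2 : ℤ) = 1 := by norm_num
  rw [h2]
  -- The vacuum modes leave at most one i: i = -1 - n from the first product if n < 0, i = n - 1
  -- from the second if n > 0, none if n = 0. The coefficient i + 1, with the sign of its product,
  -- is -n.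
  rcases lt_trichotomy n 0 with hn | rfl | hn
  · rw [finsum_eq_single _ (-1 - n).toNat fun i hi => by
      rw [if_neg (by omega), if_neg (by omega)]; simp]
    have hc : (((-1 - n).toNat : ℕ) : ℤ) = -1 - n := Int.toNat_of_nonneg (by omega)
    have hc' : (((-1 - n).toNat : ℕ) : ℂ) = -1 - n := by
      exact_mod_cast congrArg (Int.cast : ℤ → ℂ) hc
    rw [if_pos (by omega), if_neg (by omega), hc, hc', show -2 - (-1 - n) = n - 1 by ring]
    module
  · rw [finsum_eq_zero_of_forall_eq_zero fun i => by
      rw [if_neg (by omega), if_neg (by omega)]; simp]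
    simp
  · rw [finsum_eq_single _ (n - 1).toNat fun i hi => by
      rw [if_neg (by omega), if_neg (by omega)]; simp]
    have hc : (((n - 1).toNat : ℕ) : ℤ) = n - 1 := Int.toNat_of_nonneg (by omega)
    have hc' : (((n - 1).toNat : ℕ) : ℂ) = n - 1 := by
      exact_mod_cast congrArg (Int.cast : ℤ → ℂ) hc
    rw [if_neg (by omega), if_pos (by omega), hc, hc', map_zero]
    module

end Vacuum

/-! ### The module axioms for W' -/

section Contragredient

variable {V : Type uV} [AddCommGroup V] [Module ℂ V]
variable {W : Type uW} [AddCommGroup W] [Module ℂ W]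

theorem contragredientY_apply (𝒱 : VOA V) (𝒲 : VOAModule 𝒱.toVertexData W) (v : V) (n : ℤ)
    (α : restrictedDual 𝒲) (w : W) :
    (contragredientY 𝒱 𝒲 v n α : Module.Dual ℂ W) w =
      (α : Module.Dual ℂ W) (𝒱.opp 𝒲.Y v n w) := rfl

theorem contragredientY_L (𝒱 : VOA V) (𝒲 : VOAModule 𝒱.toVertexData W) (n : ℤ)
    (α : restrictedDual 𝒲) (w : W) :
    (𝒱.L (contragredientY 𝒱 𝒲) n α : Module.Dual ℂ W) w =
      (α : Module.Dual ℂ W) (𝒱.L 𝒲.Y (-n) w) := by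
  rw [VertexData.L, contragredientY_apply, 𝒱.opp_omega]

/-- L(0) on W' is the transpose of L(0) on W, so a functional of weight k satisfies (k - h)α(w) = 0
for w of weight h. -/
theorem mem_wt_contragredientY (𝒱 : VOA V) (𝒲 : VOAModule 𝒱.toVertexData W) {k : ℂ}
    {α : restrictedDual 𝒲} : α ∈ 𝒱.wt (contragredientY 𝒱 𝒲) k ↔
      ∀ h, h ≠ k → ∀ w ∈ 𝒱.wt 𝒲.Y h, (α : Module.Dual ℂ W) w = 0 := by
  have key : ∀ h, ∀ w ∈ 𝒱.wt 𝒲.Y h, (𝒱.L (contragredientY 𝒱 𝒲) 0 α : Module.Dual ℂ W) w =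
      h * (α : Module.Dual ℂ W) w := fun h w hw => by
    rw [VertexData.wt, Module.End.mem_eigenspace_iff] at hw
    rw [contragredientY_L, neg_zero, hw, map_smul, smul_eq_mul]
  constructor
  · intro hα h hne w hw
    have h1 := key h w hw
    rw [VertexData.wt, Module.End.mem_eigenspace_iff] at hα
    rw [hα, Submodule.coe_smul, LinearMap.smul_apply, smul_eq_mul] at h1
    have h2 : (k - h) * (α : Module.Dual ℂ W) w = 0 := by linear_combination h1
    exact (mul_eq_zero.1 h2).resolve_left (sub_ne_zero.2 hne.symm)
  · intro hα
    rw [VertexData.wt, Module.End.mem_eigenspace_iff]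
    refine Subtype.ext (linearMap_eq_of_eqOn_eigenspaces 𝒲.isModule.semisimple fun h w hw => ?_)
    rw [key h w hw, Submodule.coe_smul, LinearMap.smul_apply, smul_eq_mul]
    by_cases hne : h = k
    · rw [hne]
    · rw [hα h hne w hw, mul_zero, mul_zero]

/-- The extension by zero of a functional on `W_(k)`. -/
def extendDual {D : VertexData V} (𝒲 : VOAModule D W) (k : ℂ) :
    Module.Dual ℂ (D.wt 𝒲.Y k) →ₗ[ℂ] restrictedDual 𝒲 :=
  (eigenProj (D.L 𝒲.Y 0) k).dualMap.codRestrict (restrictedDual 𝒲) fun β => by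
    refine (Set.finite_singleton k).subset ?_
    rintro h ⟨w, hw, hne⟩
    by_contra hk
    refine hne ?_
    rw [LinearMap.dualMap_apply, eigenProj_of_mem 𝒲.isModule.semisimple hw (Ne.symm hk)]
    exact map_zero β

theorem extendDual_apply {D : VertexData V} (𝒲 : VOAModule D W) (k : ℂ)
    (β : Module.Dual ℂ (D.wt 𝒲.Y k)) (w : W) :
    (extendDual 𝒲 k β : Module.Dual ℂ W) w = β (eigenProj (D.L 𝒲.Y 0) k w) := rfl

theorem extendDual_apply_coe {D : VertexData V} (𝒲 : VOAModule D W) (k : ℂ)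
    (β : Module.Dual ℂ (D.wt 𝒲.Y k)) (w : D.wt 𝒲.Y k) :
    (extendDual 𝒲 k β : Module.Dual ℂ W) w = β w := by
  rw [extendDual_apply]
  congr 1
  exact Subtype.ext (eigenProj_of_mem_self 𝒲.isModule.semisimple w.2)

theorem extendDual_mem (𝒱 : VOA V) (𝒲 : VOAModule 𝒱.toVertexData W) (k : ℂ)
    (β : Module.Dual ℂ (𝒱.wt 𝒲.Y k)) :
    extendDual 𝒲 k β ∈ 𝒱.wt (contragredientY 𝒱 𝒲) k := by
  rw [mem_wt_contragredientY]
  intro h hne w hw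
  rw [extendDual_apply, eigenProj_of_mem 𝒲.isModule.semisimple hw hne.symm]
  exact map_zero β

/-- With `extendDual_mem` and `extendDual_apply_coe`, this identifies the weight space W'_(k) with
the dual of W_(k). -/
theorem extendDual_restrict (𝒱 : VOA V) (𝒲 : VOAModule 𝒱.toVertexData W) {k : ℂ}
    {α : restrictedDual 𝒲} (hα : α ∈ 𝒱.wt (contragredientY 𝒱 𝒲) k) :
    extendDual 𝒲 k ((α : Module.Dual ℂ W) ∘ₗ (𝒱.wt 𝒲.Y k).subtype) = α := by
  refine Subtype.ext (linearMap_eq_of_eqOn_eigenspaces 𝒲.isModule.semisimple fun h w hw => ?_)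
  by_cases hne : h = k
  · subst hne
    exact extendDual_apply_coe 𝒲 h _ ⟨w, hw⟩
  · rw [(mem_wt_contragredientY 𝒱 𝒲).1 hα h hne w hw,
      (mem_wt_contragredientY 𝒱 𝒲).1 (extendDual_mem 𝒱 𝒲 k _) h hne w hw]

/-- A term of v^o_n indexed by p shifts weights by n + 1 - p.1. Since α lives on finitely many
weights k, it can only see the weights h = k - n - 1 + p.1, and there W vanishes once n is large. -/
theorem contragredientY_truncation (𝒱 : VOA V) (𝒲 : VOAModule 𝒱.toVertexData W) (v : V)
    (α : restrictedDual 𝒲) : ∃ N : ℤ, ∀ n, N ≤ n → contragredientY 𝒱 𝒲 v n α = 0 := by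
  have hα : {h : ℂ | ∃ w ∈ 𝒱.wt 𝒲.Y h, (α : Module.Dual ℂ W) w ≠ 0}.Finite := α.2
  choose N hN using fun x : ℂ × ℤ × ℕ => 𝒲.isModule.lower (x.1 - 1 + x.2.1)
  obtain ⟨B, hB⟩ := ((hα.toFinset ×ˢ (𝒱.oppTerm_finite v).toFinset).image N).bddAbove
  refine ⟨B, fun n hn => ?_⟩
  lift n to ℕ using (by omega)
  refine Subtype.ext (linearMap_eq_of_eqOn_eigenspaces 𝒲.isModule.semisimple fun h w hw => ?_)
  rw [contragredientY_apply, 𝒱.opp_apply, map_sum]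
  refine sum_eq_zero fun p hp => ?_
  by_contra hne
  rw [map_smul] at hne
  have hmem := 𝒱.opp_term_mem 𝒲.isModule.toIsWeakModule v hw n p
  have hk : h + n + 1 - p.1 ∈ hα.toFinset := by
    rw [Set.Finite.mem_toFinset]
    exact ⟨_, by exact_mod_cast hmem, (smul_ne_zero_iff.1 hne).2⟩
  have hNB : N (h + n + 1 - p.1, p) ≤ B :=
    hB (mem_coe.2 (mem_image_of_mem _ (mk_mem_product hk hp)))
  have hbot := hN (h + n + 1 - p.1, p) n (hNB.trans (by exact_mod_cast hn))
  rw [show h + (n : ℂ) + 1 - p.1 - 1 + p.1 - n = h by ring] at hbot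
  have hw' : w ∈ 𝒱.wt 𝒲.Y h := hw
  rw [hbot, Submodule.mem_bot] at hw'
  exact hne (by rw [hw']; simp)

theorem contragredientY_vacuum (𝒱 : VOA V) (𝒲 : VOAModule 𝒱.toVertexData W) (n : ℤ)
    (α : restrictedDual 𝒲) :
    contragredientY 𝒱 𝒲 𝒱.vac n α = if n = -1 then α else 0 := by
  refine Subtype.ext (LinearMap.ext fun w => ?_)
  rw [contragredientY_apply, 𝒱.opp_vac, 𝒲.isModule.vacuum]
  by_cases hn : n = -1
  · rw [if_pos (by omega), if_pos hn]
  · rw [if_neg (by omega), if_neg hn]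
    simp

/-- Transposition reverses products, which undoes the reversal in `VOA.opp_jacobi_eventually`. -/
theorem contragredientY_jacobi (𝒱 : VOA V) (𝒲 : VOAModule 𝒱.toVertexData W) (u v : V)
    (α : restrictedDual 𝒲) (l m n : ℤ) :
    ∑ᶠ i : ℕ, binom m i • contragredientY 𝒱 𝒲 (𝒱.Y u (l + i) v) (m + n - i) α =
      ∑ᶠ i : ℕ, ((-1) ^ i * binom l i) •
        (contragredientY 𝒱 𝒲 u (m + l - i) (contragredientY 𝒱 𝒲 v (n + i) α) -
          ((-1 : ℂ) ^ l) •
            contragredientY 𝒱 𝒲 v (n + l - i) (contragredientY 𝒱 𝒲 u (m + i) α)) := by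
  refine Subtype.ext (LinearMap.ext fun w => ?_)
  obtain ⟨N, ⟨e1, e2⟩, e3⟩ := ((𝒱.finsum_jacobi_eventually (contragredientY_truncation 𝒱 𝒲) u v α l m n).and
    (𝒱.opp_jacobi_eventually 𝒲.isModule.toIsWeakModule u v w l m n)).exists
  have e4 := congrArg (α : Module.Dual ℂ W) e3
  rw [e1, e2]
  simpa only [Submodule.coe_sum, Submodule.coe_smul, Submodule.coe_sub, LinearMap.sum_apply,
    LinearMap.smul_apply, LinearMap.sub_apply, contragredientY_apply, map_sum, map_smul,
    map_sub] using e4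

theorem contragredientY_virasoro (𝒱 : VOA V) (𝒲 : VOAModule 𝒱.toVertexData W) (m n : ℤ)
    (α : restrictedDual 𝒲) :
    𝒱.L (contragredientY 𝒱 𝒲) m (𝒱.L (contragredientY 𝒱 𝒲) n α) -
        𝒱.L (contragredientY 𝒱 𝒲) n (𝒱.L (contragredientY 𝒱 𝒲) m α) =
      ((m : ℂ) - n) • 𝒱.L (contragredientY 𝒱 𝒲) (m + n) α +
        (if m + n = 0 then (((m : ℂ) ^ 3 - m) / 12 * 𝒱.rank) • α else 0) := by
  refine Subtype.ext (LinearMap.ext fun w => ?_)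
  -- Transposing sends L(m), L(n) to L(-m), L(-n) and reverses their order, hence the arguments -n,
  -- -m.
  have h := congrArg (α : Module.Dual ℂ W) (𝒲.isModule.virasoro (-n) (-m) w)
  rw [map_sub, map_add, map_smul] at h
  rw [Submodule.coe_sub, Submodule.coe_add, Submodule.coe_smul, LinearMap.sub_apply,
    LinearMap.add_apply, LinearMap.smul_apply]
  simp only [contragredientY_L]
  rw [h, show -n + -m = -(m + n) by ring]
  congr 1
  · push_cast
    congr 1
    ring
  · by_cases hmn : m + n = 0
    · obtain rfl : n = -m := by omega
      rw [if_pos (by omega), if_pos hmn, neg_neg, map_smul]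
      rfl
    · rw [if_neg (by omega), if_neg hmn, map_zero]
      rfl

/-- The contragredient of a module is a module. -/
theorem contragredientY_isModule (𝒱 : VOA V) (𝒲 : VOAModule 𝒱.toVertexData W) :
    IsModule 𝒱.toVertexData (contragredientY 𝒱 𝒲) where
  truncation := contragredientY_truncation 𝒱 𝒲
  vacuum := contragredientY_vacuum 𝒱 𝒲
  jacobi := contragredientY_jacobi 𝒱 𝒲
  virasoro := contragredientY_virasoro 𝒱 𝒲
  derivative := 𝒱.derivative_of_jacobi (contragredientY_vacuum 𝒱 𝒲) (contragredientY_jacobi 𝒱 𝒲)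
  semisimple := by
    rw [eq_top_iff]
    rintro α -
    have hα : {h : ℂ | ∃ w ∈ 𝒱.wt 𝒲.Y h, (α : Module.Dual ℂ W) w ≠ 0}.Finite := α.2
    -- α is the sum of the extensions by zero of its restrictions to the finitely many weight spaces
    -- where it is nonzero.
    have e : α = ∑ h ∈ hα.toFinset,
        extendDual 𝒲 h ((α : Module.Dual ℂ W) ∘ₗ (𝒱.wt 𝒲.Y h).subtype) := by
      refine Subtype.ext (linearMap_eq_of_eqOn_eigenspaces 𝒲.isModule.semisimple fun k w hw => ?_)
      rw [Submodule.coe_sum, LinearMap.sum_apply]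
      by_cases hk : k ∈ hα.toFinset
      · rw [sum_eq_single_of_mem k hk fun h _ hne =>
          (mem_wt_contragredientY 𝒱 𝒲).1 (extendDual_mem 𝒱 𝒲 h _) k hne.symm w hw]
        exact (extendDual_apply_coe 𝒲 k ((α : Module.Dual ℂ W) ∘ₗ (𝒱.wt 𝒲.Y k).subtype)
          ⟨w, hw⟩).symm
      · rw [sum_eq_zero fun h hh => (mem_wt_contragredientY 𝒱 𝒲).1 (extendDual_mem 𝒱 𝒲 h _) k
          (fun hne => hk (hne ▸ hh)) w hw]
        by_contra hne
        exact hk (hα.mem_toFinset.2 ⟨w, hw, hne⟩)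
    rw [e]
    exact Submodule.sum_mem _ fun h _ => Submodule.mem_iSup_of_mem h (extendDual_mem 𝒱 𝒲 h _)
  finite_dim k := by
    have := 𝒲.isModule.finite_dim k
    refine Module.Finite.of_injective
      (((𝒱.wt 𝒲.Y k).subtype.dualMap ∘ₗ (restrictedDual 𝒲).subtype) ∘ₗ
        (𝒱.wt (contragredientY 𝒱 𝒲) k).subtype) fun α β hαβ => Subtype.ext ?_
    rw [← extendDual_restrict 𝒱 𝒲 α.2, ← extendDual_restrict 𝒱 𝒲 β.2]
    exact congrArg (extendDual 𝒲 k) hαβ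
  lower h := by
    obtain ⟨N, hN⟩ := 𝒲.isModule.lower h
    refine ⟨N, fun n hn => (Submodule.eq_bot_iff _).2 fun α hα => ?_⟩
    refine Subtype.ext (linearMap_eq_of_eqOn_eigenspaces 𝒲.isModule.semisimple fun k w hw => ?_)
    by_cases hk : k = h - n
    · have hw' : w ∈ 𝒱.wt 𝒲.Y k := hw
      rw [hk, hN n hn, Submodule.mem_bot] at hw'
      rw [hw', map_zero, map_zero]
    · exact (mem_wt_contragredientY 𝒱 𝒲).1 hα k hk w hw

end Contragredient

/-! ### Homomorphic images of modules -/

section Image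

variable {V : Type uV} [AddCommGroup V] [Module ℂ V]

/-- The images of the eigenspaces of T lie in those of S and together span N. As the eigenspaces of
S are independent, none can exceed the corresponding image; the modular law makes this precise. -/
theorem eigenspace_eq_map {M N : Type*} [AddCommGroup M] [Module ℂ M] [AddCommGroup N] [Module ℂ N]
    {T : Module.End ℂ M} {S : Module.End ℂ N} {g : M →ₗ[ℂ] N} (hg : ∀ x, g (T x) = S (g x))
    (hs : Function.Surjective g) (hT : ⨆ h : ℂ, Module.End.eigenspace T h = ⊤) (h : ℂ) :
    Module.End.eigenspace S h = (Module.End.eigenspace T h).map g := by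
  have hle : ∀ k, (Module.End.eigenspace T k).map g ≤ Module.End.eigenspace S k := by
    rintro k _ ⟨x, hx, rfl⟩
    rw [SetLike.mem_coe, Module.End.mem_eigenspace_iff] at hx
    rw [Module.End.mem_eigenspace_iff, ← hg, hx, map_smul]
  refine le_antisymm ?_ (hle h)
  set X := ⨆ k, ⨆ _ : k ≠ h, (Module.End.eigenspace T k).map g with hX
  have htop : (Module.End.eigenspace T h).map g ⊔ X = ⊤ := by
    rw [eq_top_iff, ← LinearMap.range_eq_top.2 hs, LinearMap.range_eq_map, ← hT, Submodule.map_iSup]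
    refine iSup_le fun k => ?_
    by_cases hk : k = h
    · rw [hk]
      exact le_sup_left
    · exact le_sup_of_le_right (le_iSup₂_of_le k hk le_rfl)
  have hdis : Disjoint X (Module.End.eigenspace S h) :=
    (Module.End.eigenspaces_iSupIndep S h).symm.mono_left (iSup₂_mono fun k _ => hle k)
  calc Module.End.eigenspace S h
      = ((Module.End.eigenspace T h).map g ⊔ X) ⊓ Module.End.eigenspace S h := by
        rw [htop, top_inf_eq]
    _ = (Module.End.eigenspace T h).map g ⊔ X ⊓ Module.End.eigenspace S h :=
        sup_inf_assoc_of_le X (hle h)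
    _ ≤ (Module.End.eigenspace T h).map g := by rw [hdis.eq_bot, sup_bot_eq]

/-- Identities push forward along g. The conditions on the grading do so because every weight space
of N is the image of that of M, by `eigenspace_eq_map`. -/
theorem IsModule.of_surjective {D : VertexData V} {M N : Type*} [AddCommGroup M] [Module ℂ M]
    [AddCommGroup N] [Module ℂ N] {Y₁ : V →ₗ[ℂ] ℤ → Module.End ℂ M}
    {Y₂ : V →ₗ[ℂ] ℤ → Module.End ℂ N} (hM : IsModule D Y₁) {g : M →ₗ[ℂ] N}
    (hg : ∀ v n x, g (Y₁ v n x) = Y₂ v n (g x)) (hs : Function.Surjective g) : IsModule D Y₂ := by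
  have hL : ∀ n x, g (D.L Y₁ n x) = D.L Y₂ n (g x) := fun n x => hg _ _ x
  have hwt : ∀ h, D.wt Y₂ h = (D.wt Y₁ h).map g := eigenspace_eq_map (hL 0) hs hM.semisimple
  have htrunc : ∀ (v : V) (w : N), ∃ K : ℤ, ∀ n, K ≤ n → Y₂ v n w = 0 := by
    intro v w
    obtain ⟨x, rfl⟩ := hs w
    obtain ⟨K, hK⟩ := hM.truncation v x
    exact ⟨K, fun n hn => by rw [← hg, hK n hn, map_zero]⟩
  refine
    { truncation := htrunc
      vacuum := ?_
      jacobi := ?_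
      virasoro := ?_
      derivative := ?_
      semisimple := ?_
      finite_dim := ?_
      lower := ?_ }
  · intro n w
    obtain ⟨x, rfl⟩ := hs w
    rw [← hg, hM.vacuum, apply_ite g, map_zero]
  · intro u v w l m n
    obtain ⟨x, rfl⟩ := hs w
    obtain ⟨K, ⟨e1, e2⟩, e3⟩ := ((D.finsum_jacobi_eventually htrunc u v (g x) l m n).and
      (hM.toIsWeakModule.jacobi_eventually u v x l m n)).exists
    rw [e1, e2]
    simpa only [map_sum, map_smul, map_sub, hg] using congrArg g e3
  · intro m n w
    obtain ⟨x, rfl⟩ := hs w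
    simpa only [map_add, map_smul, map_sub, hL, apply_ite g, map_zero] using
      congrArg g (hM.virasoro m n x)
  · intro v n w
    obtain ⟨x, rfl⟩ := hs w
    rw [← hg, ← hg, hM.derivative, map_smul]
  · simp only [hwt]
    rw [← Submodule.map_iSup, hM.semisimple, ← LinearMap.range_eq_map, LinearMap.range_eq_top.2 hs]
  · intro h
    have := hM.finite_dim h
    rw [hwt]
    infer_instance
  · intro h
    obtain ⟨K, hK⟩ := hM.lower h
    exact ⟨K, fun n hn => by rw [hwt, hK n hn, Submodule.map_bot]⟩

end Image

/-! ### Intertwining maps and homomorphisms -/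

/-! ### The pairing of W' with the completion of W -/

section Pairing

variable {V : Type uV} [AddCommGroup V] [Module ℂ V]
variable {W : Type uW} [AddCommGroup W] [Module ℂ W]

theorem pairing_of_mem (𝒱 : VOA V) (𝒲 : VOAModule 𝒱.toVertexData W) {k : ℂ}
    {α : restrictedDual 𝒲} (hα : α ∈ 𝒱.wt (contragredientY 𝒱 𝒲) k) (f : completion 𝒲) :
    pairing 𝒲 α f = (α : Module.Dual ℂ W) (f k) :=
  finsum_eq_single _ k fun h hne => (mem_wt_contragredientY 𝒱 𝒲).1 hα h hne _ (f h).2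

theorem pairing_extendDual (𝒱 : VOA V) (𝒲 : VOAModule 𝒱.toVertexData W) {k : ℂ}
    (β : Module.Dual ℂ (𝒱.wt 𝒲.Y k)) (f : completion 𝒲) :
    pairing 𝒲 (extendDual 𝒲 k β) f = β (f k) := by
  rw [pairing_of_mem 𝒱 𝒲 (extendDual_mem 𝒱 𝒲 k β), extendDual_apply_coe]

/-- Reduces statements about W' to functionals living on one weight space, for which the pairing
with the completion reads off a single component. -/
theorem restrictedDual_induction (𝒱 : VOA V) (𝒲 : VOAModule 𝒱.toVertexData W)
    {P : restrictedDual 𝒲 → Prop} (α : restrictedDual 𝒲)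
    (homogeneous : ∀ (k : ℂ) (β : Module.Dual ℂ (𝒱.wt 𝒲.Y k)), P (extendDual 𝒲 k β))
    (zero : P 0) (add : ∀ α β, P α → P β → P (α + β)) : P α := by
  refine Submodule.iSup_induction (𝒱.wt (contragredientY 𝒱 𝒲)) (motive := P) (x := α)
    ((contragredientY_isModule 𝒱 𝒲).semisimple ▸ Submodule.mem_top) (fun k γ hγ => ?_) zero add
  rw [← extendDual_restrict 𝒱 𝒲 hγ]
  exact homogeneous k _

theorem pairing_contragredientY (𝒱 : VOA V) (𝒲 : VOAModule 𝒱.toVertexData W) (v : V) (n : ℤ)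
    (α : restrictedDual 𝒲) (f : completion 𝒲) :
    pairing 𝒲 (contragredientY 𝒱 𝒲 v n α) f = pairing 𝒲 α (extendOpp 𝒱 𝒲 v n f) := by
  induction α using restrictedDual_induction with
  | zero => simp
  | add α β hα hβ => simp only [map_add, LinearMap.add_apply, hα, hβ]
  | homogeneous k β =>
    rw [pairing_extendDual]
    exact (map_finsum β (extend_finite 𝒱 𝒲 v n f k)).symm

end Pairing

/-! ### Transposition between intertwining maps and homomorphisms -/

section Main

variable {V : Type uV} [AddCommGroup V] [Module ℂ V]
variable {W : Type uW} [AddCommGroup W] [Module ℂ W]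
variable {A : Type uA} [AddCommGroup A] [Module ℂ A]
variable (𝒱 : VOA V) (𝒜 : VOAModule 𝒱.tensorSquare A) (z : ℂ)
variable (𝒲 : VOAModule 𝒱.toVertexData W)

theorem qzY_apply (v : V) (n : ℤ) (lam : Module.Dual ℂ A) (a : A) :
    qzY 𝒱 𝒜 z v n lam a = lam (qzTerm 𝒱 𝒜 z n 0 v a) := rfl

variable {𝒱 𝒜 z 𝒲}

/-- The case t = 0 of the defining identity is its residue in x₁: the binomials (0 choose i) leave
only i = 0. -/
theorem qzTerm_zero_of_mem_intertwiningMaps {F : A →ₗ[ℂ] completion 𝒲}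
    (hF : F ∈ intertwiningMaps 𝒱 𝒜 z 𝒲) (v : V) (n : ℤ) (a : A) :
    F (qzTerm 𝒱 𝒜 z n 0 v a) = extendOpp 𝒱 𝒲 v n (F a) := by
  ext1 k
  rw [← hF v a n 0 k, finsum_eq_sum_range (N := 1) fun i hi => by
    rw [binom_zero_left, if_neg (by omega), zero_mul, zero_smul]]
  simp [binom_zero_right]

theorem dualMap_pairing_contragredientY {F : A →ₗ[ℂ] completion 𝒲}
    (hF : F ∈ intertwiningMaps 𝒱 𝒜 z 𝒲) (v : V) (n : ℤ) (α : restrictedDual 𝒲) :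
    (F.dualMap ∘ₗ pairing 𝒲) (contragredientY 𝒱 𝒲 v n α) =
      qzY 𝒱 𝒜 z v n ((F.dualMap ∘ₗ pairing 𝒲) α) := by
  refine LinearMap.ext fun a => ?_
  rw [qzY_apply]
  simp only [LinearMap.comp_apply, LinearMap.dualMap_apply]
  rw [pairing_contragredientY, qzTerm_zero_of_mem_intertwiningMaps hF]

/-- Truncation is inherited from W' by equivariance. The identity results from applying β to the
weight k component of the defining identity of F. -/
theorem dualMap_pairing_mem_compatible {F : A →ₗ[ℂ] completion 𝒲}
    (hF : F ∈ intertwiningMaps 𝒱 𝒜 z 𝒲) (α : restrictedDual 𝒲) :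
    (F.dualMap ∘ₗ pairing 𝒲) α ∈ compatible 𝒱 𝒜 z := by
  induction α using restrictedDual_induction with
  | zero =>
    rw [map_zero]
    exact zero_mem _
  | add α β hα hβ =>
    rw [map_add]
    exact add_mem hα hβ
  | homogeneous k β =>
    refine ⟨fun v => ?_, fun v a s t => ?_⟩
    · obtain ⟨N, hN⟩ := contragredientY_truncation 𝒱 𝒲 v (extendDual 𝒲 k β)
      exact ⟨N, fun n hn => by rw [← dualMap_pairing_contragredientY hF, hN n hn, map_zero]⟩
    · simp only [← dualMap_pairing_contragredientY hF]
      simp only [LinearMap.comp_apply, LinearMap.dualMap_apply, pairing_contragredientY,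
        pairing_extendDual]
      rw [← hF v a s t k, map_finsum β (qz_middle_finite 𝒱 z 𝒲 v s t (F a) k)]
      simp only [map_smul]

/-- The whole image of W' is one of the subspaces whose sum is T': it is stable, compatible, and a
quotient of the module W'. -/
theorem dualMap_pairing_mem_tPrime {F : A →ₗ[ℂ] completion 𝒲}
    (hF : F ∈ intertwiningMaps 𝒱 𝒜 z 𝒲) (α : restrictedDual 𝒲) :
    (F.dualMap ∘ₗ pairing 𝒲) α ∈ tPrime 𝒱 𝒜 z := by
  have hstable : IsStable (qzY 𝒱 𝒜 z) (LinearMap.range (F.dualMap ∘ₗ pairing 𝒲)) := by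
    rintro v n _ ⟨β, rfl⟩
    exact ⟨_, dualMap_pairing_contragredientY hF v n β⟩
  refine (le_sSup (show LinearMap.range (F.dualMap ∘ₗ pairing 𝒲) ∈ _ from
    ⟨?_, hstable, ?_⟩) : _ ≤ tPrime 𝒱 𝒜 z) ⟨α, rfl⟩
  · rintro _ ⟨β, rfl⟩
    exact dualMap_pairing_mem_compatible hF β
  · exact (contragredientY_isModule 𝒱 𝒲).of_surjective
      (g := (F.dualMap ∘ₗ pairing 𝒲).rangeRestrict)
      (fun v n β => Subtype.ext (dualMap_pairing_contragredientY hF v n β))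
      (LinearMap.surjective_rangeRestrict _)

theorem tPrime_le_compatible : tPrime 𝒱 𝒜 z ≤ compatible 𝒱 𝒜 z := sSup_le fun _ hU => hU.1

variable (𝒱 𝒜 z 𝒲)

/-- The map `f ↦ f^*|_{W'}` from intertwining maps to homomorphisms. -/
def intertwiningMapsToHom :
    intertwiningMaps 𝒱 𝒜 z 𝒲 →ₗ[ℂ] homV (contragredientY 𝒱 𝒲) (tPrimeY 𝒱 𝒜 z) where
  toFun F := ⟨((F : A →ₗ[ℂ] completion 𝒲).dualMap ∘ₗ pairing 𝒲).codRestrict (tPrime 𝒱 𝒜 z)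
      (dualMap_pairing_mem_tPrime F.2),
    fun v n α => Subtype.ext (dualMap_pairing_contragredientY F.2 v n α)⟩
  map_add' F G := by
    refine Subtype.ext (LinearMap.ext fun α => Subtype.ext (LinearMap.ext fun a => ?_))
    exact map_add (pairing 𝒲 α) ((F : A →ₗ[ℂ] completion 𝒲) a) ((G : A →ₗ[ℂ] completion 𝒲) a)
  map_smul' c F := by
    refine Subtype.ext (LinearMap.ext fun α => Subtype.ext (LinearMap.ext fun a => ?_))
    exact map_smul (pairing 𝒲 α) c ((F : A →ₗ[ℂ] completion 𝒲) a)

theorem intertwiningMapsToHom_apply (F : intertwiningMaps 𝒱 𝒜 z 𝒲) (α : restrictedDual 𝒲) (a : A) :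
    (((intertwiningMapsToHom 𝒱 𝒜 z 𝒲 F : restrictedDual 𝒲 →ₗ[ℂ] tPrime 𝒱 𝒜 z) α :
      tPrime 𝒱 𝒜 z) : Module.Dual ℂ A) a = pairing 𝒲 α ((F : A →ₗ[ℂ] completion 𝒲) a) := rfl

/-- Functionals on W_(k), extended by zero to W', already separate the k-components of points of the
completion. -/
theorem intertwiningMapsToHom_injective :
    Function.Injective (intertwiningMapsToHom 𝒱 𝒜 z 𝒲) := by
  intro F G hFG
  refine Subtype.ext (LinearMap.ext fun a => funext fun k => ?_)
  rw [← sub_eq_zero, ← Module.forall_dual_apply_eq_zero_iff ℂ]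
  intro β
  rw [map_sub, sub_eq_zero, ← pairing_extendDual, ← pairing_extendDual,
    ← intertwiningMapsToHom_apply, ← intertwiningMapsToHom_apply, hFG]

variable {𝒱 𝒲}

/-- The map from `A` to the completion of `W` whose transpose is a given map `W' → A^*`. -/
def ofRestrictedDual (g : restrictedDual 𝒲 →ₗ[ℂ] Module.Dual ℂ A) : A →ₗ[ℂ] completion 𝒲 :=
  LinearMap.pi fun k =>
    -- For fixed a, the map β ↦ g(`extendDual 𝒲 k β`)(a) lies in W_(k)^{**}, which is W_(k) by
    -- finite dimension; this vector is the k-component.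
    have := 𝒲.isModule.finite_dim k
    (Module.evalEquiv ℂ (𝒱.wt 𝒲.Y k)).symm.toLinearMap ∘ₗ (g ∘ₗ extendDual 𝒲 k).flip

theorem pairing_ofRestrictedDual (g : restrictedDual 𝒲 →ₗ[ℂ] Module.Dual ℂ A)
    (α : restrictedDual 𝒲) (a : A) : pairing 𝒲 α (ofRestrictedDual g a) = g α a := by
  induction α using restrictedDual_induction with
  | zero => simp
  | add α β hα hβ => simp only [map_add, LinearMap.add_apply, hα, hβ]
  | homogeneous k β =>
    have := 𝒲.isModule.finite_dim k
    rw [pairing_extendDual]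
    exact Module.apply_evalEquiv_symm_apply ℂ _ β ((g ∘ₗ extendDual 𝒲 k).flip a)

/-- Tested against every β in W_(k)^*, the defining identity becomes, by equivariance of g, the
compatibility identity for the functional g(`extendDual 𝒲 k β`). -/
theorem ofRestrictedDual_mem
    {g : restrictedDual 𝒲 →ₗ[ℂ] Module.Dual ℂ A}
    (hg : ∀ v n α, g (contragredientY 𝒱 𝒲 v n α) = qzY 𝒱 𝒜 z v n (g α))
    (hc : ∀ α, g α ∈ compatible 𝒱 𝒜 z) :
    ofRestrictedDual g ∈ intertwiningMaps 𝒱 𝒜 z 𝒲 := by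
  intro v a s t k
  rw [← sub_eq_zero, ← Module.forall_dual_apply_eq_zero_iff ℂ]
  intro β
  rw [map_sub, sub_eq_zero, map_finsum β (qz_middle_finite 𝒱 z 𝒲 v s t _ k)]
  simp only [map_smul, ← pairing_extendDual, ← pairing_contragredientY, pairing_ofRestrictedDual,
    hg]
  exact (hc _).2 v a s t

end Main

end

theorem theorem5p9 {V : Type*} [AddCommGroup V] [Module ℂ V]
    {W : Type*} [AddCommGroup W] [Module ℂ W]
    {A : Type*} [AddCommGroup A] [Module ℂ A]
    (𝒱 : VOA V) (𝒜 : VOAModule 𝒱.tensorSquare A) (𝒲 : VOAModule 𝒱.toVertexData W)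
    (z : ℂ) (hz : z ≠ 0) :
    ∃ e : intertwiningMaps 𝒱 𝒜 z 𝒲 ≃ₗ[ℂ] homV (contragredientY 𝒱 𝒲) (tPrimeY 𝒱 𝒜 z),
      ∀ (f : intertwiningMaps 𝒱 𝒜 z 𝒲) (w' : restrictedDual 𝒲),
        (((e f : restrictedDual 𝒲 →ₗ[ℂ] tPrime 𝒱 𝒜 z) w' : tPrime 𝒱 𝒜 z) : Module.Dual ℂ A) =
          ((f : A →ₗ[ℂ] completion 𝒲).dualMap ∘ₗ pairing 𝒲) w' := by
  refine ⟨LinearEquiv.ofBijective (intertwiningMapsToHom 𝒱 𝒜 z 𝒲)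
    ⟨intertwiningMapsToHom_injective 𝒱 𝒜 z 𝒲, fun g => ?_⟩, fun f w' => rfl⟩
  obtain ⟨g, hg⟩ := g
  -- Surjectivity: elements of T' are compatible, so g followed by the inclusion into A^* comes from
  -- an intertwining map.
  refine ⟨⟨ofRestrictedDual ((tPrime 𝒱 𝒜 z).subtype ∘ₗ g), ofRestrictedDual_mem 𝒜 z
    (fun v n α => congrArg Subtype.val (hg v n α)) fun α => tPrime_le_compatible (g α).2⟩,
    Subtype.ext (LinearMap.ext fun α => Subtype.ext (LinearMap.ext fun a => ?_))⟩
  exact pairing_ofRestrictedDual _ α a
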